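/- Let $d\in\mathbb N$ and write points of $\mathbb R^{2d}$ as $(x,v)$ with $x,v\in\mathbb R^d$. Put $|(x,v)|_{\mathtt k}=|x|^{1/3}+|v|$ and $2^{-\mathtt k j}(\xi,\eta)=(2^{-3j}\xi,2^{-j}\eta)$. Fix $\phi_{-1}\in C_c^\infty(\mathbb R^{2d})$ with $0\le\phi_{-1}\le 1$, $\phi_{-1}=1$ on $\{|\cdot|_{\mathtt k}\le 1/2\}$ and $\phi_{-1}=0$ on $\{|\cdot|_{\mathtt k}>2/3\}$, and for integers $j\ge 0$ let $\phi_j=\phi_{-1}(2^{-\mathtt k(j+1)}\,\cdot)-\phi_{-1}(2^{-\mathtt k j}\,\cdot)$. With the Fourier transform $\hat f(\xi,\eta)=\int e^{-i(\xi\cdot x+\eta\cdot v)}f(x,v)\,dx\,dv$, extended to tempered distributions (complex-valued), let $\mathcal R_jf=(\phi_j\hat f)^{\vee}$ for $j\ge-1$. For $s\in\mathbb R$ and $p,q\in[1,\infty]$ set $$\|f\|_{\mathcal B^s_{p,q;\mathtt k}}=\Big(\sum_{j\ge-1}\big(2^{sj}\|\mathcal R_jf\|_{L^p}\big)^q\Big)^{1/q}$$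 (a supremum over $j$ if $q=\infty$), and let $\mathcal H^s_{\mathtt k}=\{f\in\mathcal S'(\mathbb R^{2d}):\|f\|_{\mathcal B^s_{2,2;\mathtt k}}<\infty\}$ and $\mathcal C^r_{\mathtt k}=\{g\in\mathcal S'(\mathbb R^{2d}):\|g\|_{\mathcal C^r_{\mathtt k}}:=\|g\|_{\mathcal B^r_{\infty,\infty;\mathtt k}}<\infty\}$. Further let $$\|f\|_s=\Big(\int_{\mathbb R^{2d}}(1+|\xi|^{2/3}+|\eta|^2)^s\,|\hat f(\xi,\eta)|^2\,d\xi\,d\eta\Big)^{1/2}.$$ Let $s,r\ge 0$ with $r>s$ and $r$ not an integer. Then there is a constant $C>0$, depending only on $d,s,r$ and $\phi_{-1}$, such that for all $f\in\mathcal H^s_{\mathtt k}$ and $g\in\mathcal C^r_{\mathtt k}$ the following holds: $f$ and $g$ are given by locally integrable functions, their pointwise product $fg$ is locally integrable and defines an element of $\mathcal H^s_{\mathtt k}$, and $$\|fg\|_s\le C\,\|g\|_{\mathcal C^r_{\mathtt k}}\,\|f\|_s .$$ -/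

import Mathlib

open MeasureTheory Real
open scoped ENNReal ContDiff SchwartzMap FourierTransform

noncomputable section

namespace Kinetic

/-- The phase space `ℝ^{2d}` of points `(x, v)` with `x, v ∈ ℝ^d`, with its Euclidean structure. -/
abbrev Phase (d : ℕ) : Type := EuclideanSpace ℝ (Fin d ⊕ Fin d)

/-- The position component `x` of `(x, v)`. -/
def pos {d : ℕ} (z : Phase d) : EuclideanSpace ℝ (Fin d) := WithLp.toLp 2 fun i => z (Sum.inl i)

/-- The velocity component `v` of `(x, v)`. -/
def vel {d : ℕ} (z : Phase d) : EuclideanSpace ℝ (Fin d) := WithLp.toLp 2 fun i => z (Sum.inr i)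

/-- The kinetic size `|(x, v)|_k = |x|^{1/3} + |v|`. -/
def size {d : ℕ} (z : Phase d) : ℝ := ‖pos z‖ ^ (1 / 3 : ℝ) + ‖vel z‖

/-- The kinetic dilation `2^{-k j} (ξ, η) = (2^{-3j} ξ, 2^{-j} η)`. -/
def dil {d : ℕ} (j : ℕ) (z : Phase d) : Phase d :=
  WithLp.toLp 2 (Sum.elim (fun i => ((2 : ℝ) ^ (3 * j))⁻¹ * z (Sum.inl i))
    (fun i => ((2 : ℝ) ^ j)⁻¹ * z (Sum.inr i)))

/-- A low-frequency cutoff `φ_{-1}`: a smooth compactly supported function with values in `[0, 1]`,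
equal to `1` on the closed kinetic ball of radius `1/2` and to `0` off the one of radius `2/3`. -/
structure Cutoff (d : ℕ) where
  toFun : Phase d → ℝ
  contDiff : ContDiff ℝ ∞ toFun
  hasCompactSupport : HasCompactSupport toFun
  nonneg : ∀ z, 0 ≤ toFun z
  le_one : ∀ z, toFun z ≤ 1
  eq_one : ∀ z, size z ≤ 1 / 2 → toFun z = 1
  eq_zero : ∀ z, 2 / 3 < size z → toFun z = 0

theorem norm_eq_sqrt {d : ℕ} (z : Phase d) : ‖z‖ = √(‖pos z‖ ^ 2 + ‖vel z‖ ^ 2) := by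
  simp [EuclideanSpace.norm_eq, pos, vel, Real.sq_sqrt, Finset.sum_nonneg, sq_nonneg]

theorem continuous_size {d : ℕ} : Continuous (size : Phase d → ℝ) := by
  unfold size pos vel
  refine Continuous.add (Continuous.rpow_const ?_ fun _ => Or.inr (by norm_num)) ?_ <;> fun_prop

/-- Cutoffs exist. -/
instance {d : ℕ} : Nonempty (Cutoff d) := by
  have hA : IsClosed {z : Phase d | 2 / 3 ≤ size z} := isClosed_le continuous_const continuous_size
  have hB : IsClosed {z : Phase d | size z ≤ 1 / 2} := isClosed_le continuous_size continuous_const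
  have hAB : Disjoint {z : Phase d | 2 / 3 ≤ size z} {z : Phase d | size z ≤ 1 / 2} := by
    rw [Set.disjoint_left]
    intro z h1 h2
    simp only [Set.mem_ofPred_eq] at h1 h2
    linarith
  obtain ⟨f, h0, h1, h2⟩ := exists_contMDiffMap_zero_one_of_isClosed
    (modelWithCornersSelf ℝ (Phase d)) (n := (⊤ : ℕ∞)) hA hB hAB
  have hz : ∀ z, 2 / 3 < size z → f z = 0 := fun z hz => h0 (le_of_lt hz)
  refine ⟨⟨f, f.contMDiff.contDiff, ?_, fun z => (h2 z).1, fun z => (h2 z).2,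
    fun z hz => h1 hz, hz⟩⟩
  refine HasCompactSupport.intro (isCompact_closedBall (0 : Phase d) 2) fun z hzb => hz z ?_
  by_contra hsz
  apply hzb
  have hx : ‖pos z‖ ^ (1 / 3 : ℝ) ≤ 2 / 3 := by
    have := norm_nonneg (vel z)
    unfold size at hsz
    linarith
  have hv : ‖vel z‖ ≤ 1 := by
    have := Real.rpow_nonneg (norm_nonneg (pos z)) (1 / 3 : ℝ)
    unfold size at hsz
    linarith
  have hx1 : ‖pos z‖ ≤ 1 := by
    by_contra hc
    have := Real.one_le_rpow (le_of_not_ge hc) (by norm_num : (0 : ℝ) ≤ 1 / 3)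
    linarith
  rw [mem_closedBall_zero_iff, norm_eq_sqrt, Real.sqrt_le_left (by norm_num)]
  nlinarith [norm_nonneg (pos z), norm_nonneg (vel z)]

/-- The dyadic partition of unity; the index `n` stands for `j = n - 1`, so that `piece 0 = φ_{-1}`
and `piece (j + 1) = φ_j = φ_{-1}(2^{-k (j+1)} ·) - φ_{-1}(2^{-k j} ·)`. -/
def Cutoff.piece {d : ℕ} (φ : Cutoff d) : ℕ → Phase d → ℝ
  | 0 => φ.toFun
  | j + 1 => fun z => φ.toFun (dil (j + 1) z) - φ.toFun (dil j z)

theorem dil_add {d : ℕ} (j : ℕ) (a b : Phase d) : dil j (a + b) = dil j a + dil j b := by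
  ext (i | i) <;> simp [dil, mul_add]

theorem dil_smul {d : ℕ} (j : ℕ) (c : ℝ) (a : Phase d) : dil j (c • a) = c • dil j a := by
  ext (i | i) <;> simp [dil, mul_left_comm]

theorem dil_zero {d : ℕ} (a : Phase d) : dil 0 a = a := by
  ext (i | i) <;> simp [dil]

/-- The symbols of the block operators have temperate growth, so that the Fourier multipliers with
these symbols have their usual meaning. -/
theorem Cutoff.hasTemperateGrowth_symbol {d : ℕ} (φ : Cutoff d) (n : ℕ) :
    (fun z : Phase d => ((φ.piece n ((2 * π) • z) : ℝ) : ℂ)).HasTemperateGrowth := by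
  have key : ∀ (c : ℝ) (j : ℕ),
      (fun z : Phase d => φ.toFun (dil j (c • z))).HasTemperateGrowth := by
    intro c j
    have hφ := φ.hasCompactSupport.hasTemperateGrowth φ.contDiff
    have hL : (fun z : Phase d => dil j (c • z)).HasTemperateGrowth := by
      let L : Phase d →ₗ[ℝ] Phase d :=
        { toFun := fun z => dil j (c • z)
          map_add' := fun a b => by rw [smul_add, dil_add]
          map_smul' := fun a b => by rw [smul_comm, dil_smul, RingHom.id_apply] }
      have hLc : Continuous L := L.continuous_of_finiteDimensional
      exact ContinuousLinearMap.hasTemperateGrowth (⟨L, hLc⟩ : Phase d →L[ℝ] Phase d)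
    exact hφ.comp hL
  have hreal : (fun z : Phase d => φ.piece n ((2 * π) • z)).HasTemperateGrowth := by
    cases n with
    | zero =>
      have := key (2 * π) 0
      simpa only [Cutoff.piece, dil_zero] using this
    | succ j => exact (key _ (j + 1)).sub (key _ j)
  exact Complex.ofRealCLM.hasTemperateGrowth.comp hreal

/-- The block operator `f ↦ 𝓕⁻¹(φ_{n-1} 𝓕 f)` on tempered distributions, for the Fourier transform
with kernel `exp(-i ξ·x)`. Mathlib's has kernel `exp(-2πi ξ·x)`, whence the factor `2π`. -/
def Cutoff.block {d : ℕ} (φ : Cutoff d) (n : ℕ) (f : 𝓢'(Phase d, ℂ)) : 𝓢'(Phase d, ℂ) :=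
  TemperedDistribution.fourierMultiplierCLM ℂ
    (fun z : Phase d => ((φ.piece n ((2 * π) • z) : ℝ) : ℂ)) f

/-- The tempered distribution `T` is given by integration against the locally integrable function
`u`. -/
def IsRepresentedBy {d : ℕ} (T : 𝓢'(Phase d, ℂ)) (u : Phase d → ℂ) : Prop :=
  LocallyIntegrable u volume ∧
    ∀ ψ : 𝓢(Phase d, ℂ), Integrable (fun z => ψ z * u z) volume ∧ T ψ = ∫ z, ψ z * u z

/-- The `L^p` norm of a tempered distribution, infinite if it is not given by an `L^p` function. -/
def distLpNorm {d : ℕ} (p : ℝ≥0∞) (T : 𝓢'(Phase d, ℂ)) : ℝ≥0∞ :=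
  ⨅ (u : Phase d → ℂ) (_ : IsRepresentedBy T u), eLpNorm u p volume

/-- The kinetic Besov norm `(∑_{j ≥ -1} (2^{sj} ‖R_j f‖_{L^p})^q)^{1/q}`, a supremum for `q = ∞`. -/
def besovNorm {d : ℕ} (φ : Cutoff d) (s : ℝ) (p q : ℝ≥0∞) (f : 𝓢'(Phase d, ℂ)) : ℝ≥0∞ :=
  if q = ⊤ then ⨆ n : ℕ, (2 : ℝ≥0∞) ^ (s * ((n : ℝ) - 1)) * distLpNorm p (φ.block n f)
  else (∑' n : ℕ, ((2 : ℝ≥0∞) ^ (s * ((n : ℝ) - 1)) * distLpNorm p (φ.block n f)) ^ q.toReal)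
    ^ (1 / q.toReal)

/-- The kinetic Sobolev space `H^s_k = B^s_{2,2;k}`. -/
def MemSobolev {d : ℕ} (φ : Cutoff d) (s : ℝ) (f : 𝓢'(Phase d, ℂ)) : Prop :=
  besovNorm φ s 2 2 f < ⊤

/-- The norm of the kinetic Hölder space `C^r_k = B^r_{∞,∞;k}`. -/
def holderNorm {d : ℕ} (φ : Cutoff d) (r : ℝ) (g : 𝓢'(Phase d, ℂ)) : ℝ≥0∞ :=
  besovNorm φ r ⊤ ⊤ g

/-- The kinetic Hölder space `C^r_k`. -/
def MemHolder {d : ℕ} (φ : Cutoff d) (r : ℝ) (g : 𝓢'(Phase d, ℂ)) : Prop :=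
  holderNorm φ r g < ⊤

/-- The Hilbert norm `‖f‖_s = (∫ (1 + |ξ|^{2/3} + |η|²)^s |f̂(ξ, η)|² dξ dη)^{1/2}`, infinite if `f̂`
is not a function. Here `f̂` has kernel `exp(-i ξ·x)`: if Mathlib's transform of `f` is the function
`u`, then `f̂ = u(· / 2π)`. -/
def sobolevNorm {d : ℕ} (s : ℝ) (f : 𝓢'(Phase d, ℂ)) : ℝ≥0∞ :=
  ⨅ (u : Phase d → ℂ) (_ : IsRepresentedBy (𝓕 f) u),
    (∫⁻ z : Phase d, ENNReal.ofReal ((1 + ‖pos z‖ ^ (2 / 3 : ℝ) + ‖vel z‖ ^ 2) ^ s) *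
      ‖u ((2 * π)⁻¹ • z)‖ₑ ^ 2) ^ (1 / 2 : ℝ)

/-- `h` is the pointwise product of `g` and `f`: all three are given by functions, and that of `h`
is the product of the other two. -/
def IsPointwiseProduct {d : ℕ} (g f h : 𝓢'(Phase d, ℂ)) : Prop :=
  ∃ G F : Phase d → ℂ, IsRepresentedBy g G ∧ IsRepresentedBy f F ∧
    IsRepresentedBy h (fun z => G z * F z)

end Kinetic

end

noncomputable section

namespace Kinetic

/-! ### Kinetic size and weight -/

variable {d : ℕ}

/-! The strict gap `s < r` makes a full paraproduct decomposition unnecessary. With `ρ = 2 ^ (-r)`,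
the blocks of `g` satisfy `‖G n‖_∞ ≤ K * ρ ^ n`, where `K` is a multiple of the Hölder norm. Since
`r > 0` they sum in `L^∞` to a function `G` representing `g`. Since `s ≥ 0`, `f` is an `L²` function
`F`, and the product is the `L²` function `G F`.

To bound the `j`-th block of `G F`, split `F` into its part near the `j`-th annulus and the rest.
The near part costs at most `‖G‖_∞` times the norm of the fattened block of `F`. On the rest, every
`G n` with `n + 4 ≤ j` contributes nothing: translating the `j`-th annulus by so low a frequency
keeps it where the near symbol is `1` (`near_sub_eq_one`, `mult_mulL_mult_eq_zero`). Only the tail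
`n ≥ j - 3` remains, of size `O(K * ρ ^ j * ‖F‖)`. Multiplied by `2 ^ (s * j)`, this is square
summable exactly because `2 ^ s * ρ < 1` (`norm_mult_mulL_tsum_le`, `dyadicSq_mulL_tsum_le`).

By Plancherel, dyadic square sums compare with the weighted norm through pointwise inequalities
between symbols (`dyadicSq_near_le`, `weightSq_le`). What remains is to identify distributions with
functions: blocks sum to the distribution (`tendsto_sum_block`), and square summable blocks give an
`L²` function by almost orthogonality and Riesz representation. -/

theorem size_nonneg (z : Phase d) : 0 ≤ size z := by
  unfold size; positivity

theorem size_neg (z : Phase d) : size (-z) = size z := by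
  have h1 : pos (-z) = -pos z := by ext i; simp [pos]
  have h2 : vel (-z) = -vel z := by ext i; simp [vel]
  simp [size, h1, h2]

/-- The cube root is subadditive, so no quasi-norm constant appears. -/
theorem size_add_le (y z : Phase d) : size (y + z) ≤ size y + size z := by
  have h1 : pos (y + z) = pos y + pos z := by ext i; simp [pos]
  have h2 : vel (y + z) = vel y + vel z := by ext i; simp [vel]
  have h3 : ‖pos y + pos z‖ ^ (1 / 3 : ℝ) ≤ ‖pos y‖ ^ (1 / 3 : ℝ) + ‖pos z‖ ^ (1 / 3 : ℝ) :=
    (Real.rpow_le_rpow (norm_nonneg _) (norm_add_le _ _) (by norm_num)).trans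
      (Real.rpow_add_le_add_rpow (norm_nonneg _) (norm_nonneg _) (by norm_num) (by norm_num))
  have h4 := norm_add_le (vel y) (vel z)
  simp only [size, h1, h2]
  linarith

theorem size_dil (j : ℕ) (z : Phase d) : size (dil j z) = ((2 : ℝ) ^ j)⁻¹ * size z := by
  have h1 : pos (dil j z) = ((2 : ℝ) ^ (3 * j))⁻¹ • pos z := by ext i; simp [pos, dil]
  have h2 : vel (dil j z) = ((2 : ℝ) ^ j)⁻¹ • vel z := by ext i; simp [vel, dil]
  have h3 : (((2 : ℝ) ^ (3 * j))⁻¹) ^ (1 / 3 : ℝ) = ((2 : ℝ) ^ j)⁻¹ := by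
    have : ((2 : ℝ) ^ (3 * j))⁻¹ = (((2 : ℝ) ^ j)⁻¹) ^ (3 : ℕ) := by
      rw [inv_pow, ← pow_mul, mul_comm]
    rw [this, ← Real.rpow_natCast, ← Real.rpow_mul (by positivity)]
    norm_num
  rw [size, size, h1, h2, norm_smul, norm_smul, Real.norm_of_nonneg (by positivity),
    Real.norm_of_nonneg (by positivity), Real.mul_rpow (by positivity) (norm_nonneg _), h3, mul_add]

theorem size_le_of_norm_le (z : Phase d) {R : ℝ} (hR : 1 ≤ R) (hz : ‖z‖ ≤ R) :
    size z ≤ 2 * R := by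
  rw [norm_eq_sqrt] at hz
  have hx : ‖pos z‖ ≤ R := by
    refine (Real.le_sqrt_of_sq_le ?_).trans hz
    nlinarith [sq_nonneg ‖vel z‖]
  have hv : ‖vel z‖ ≤ R := by
    refine (Real.le_sqrt_of_sq_le ?_).trans hz
    nlinarith [sq_nonneg ‖pos z‖]
  have : ‖pos z‖ ^ (1 / 3 : ℝ) ≤ R :=
    (Real.rpow_le_rpow (norm_nonneg _) hx (by norm_num)).trans
      ((Real.rpow_le_rpow_of_exponent_le hR (by norm_num : (1 / 3 : ℝ) ≤ 1)).trans_eq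
        (Real.rpow_one R))
  unfold size
  linarith

/-- The anisotropic weight `1 + |ξ|^{2/3} + |η|²`. -/
def weight (z : Phase d) : ℝ := 1 + ‖pos z‖ ^ (2 / 3 : ℝ) + ‖vel z‖ ^ 2

theorem one_le_weight (z : Phase d) : 1 ≤ weight z := by
  have : 0 ≤ ‖pos z‖ ^ (2 / 3 : ℝ) := by positivity
  unfold weight; nlinarith [sq_nonneg ‖vel z‖]

theorem rpow_two_thirds (t : ℝ) (ht : 0 ≤ t) : t ^ (2 / 3 : ℝ) = (t ^ (1 / 3 : ℝ)) ^ 2 := by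
  rw [← Real.rpow_natCast, ← Real.rpow_mul ht]; norm_num

theorem size_sq_le (z : Phase d) : size z ^ 2 ≤ 2 * weight z := by
  rw [weight, rpow_two_thirds _ (norm_nonneg _), size]
  nlinarith [sq_nonneg (‖pos z‖ ^ (1 / 3 : ℝ) - ‖vel z‖)]

theorem weight_le (z : Phase d) : weight z ≤ 1 + size z ^ 2 := by
  rw [weight, rpow_two_thirds _ (norm_nonneg _), size]
  have : 0 ≤ ‖pos z‖ ^ (1 / 3 : ℝ) := by positivity
  nlinarith [mul_nonneg this (norm_nonneg (vel z))]

/-! ### Pointwise properties of the dyadic symbols -/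

namespace Cutoff

variable (φ : Cutoff d)

/-- The low-frequency cutoff at kinetic scale `2^(n-2)`, with value `0` for `n < 2`. -/
def low : ℕ → Phase d → ℝ
  | 0 => fun _ => 0
  | 1 => fun _ => 0
  | n + 2 => fun z => φ.toFun (dil n z)

/-- The fattened dyadic piece, equal to `1` on the support of `φ.piece n`. -/
def near (n : ℕ) (z : Phase d) : ℝ := φ.low (n + 3) z - φ.low n z

theorem low_nonneg (n : ℕ) (z : Phase d) : 0 ≤ φ.low n z := by
  match n with
  | 0 => exact le_rfl
  | 1 => exact le_rfl
  | n + 2 => exact φ.nonneg _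

theorem low_le_one (n : ℕ) (z : Phase d) : φ.low n z ≤ 1 := by
  match n with
  | 0 => exact zero_le_one
  | 1 => exact zero_le_one
  | n + 2 => exact φ.le_one _

theorem low_eq_one (n : ℕ) (z : Phase d) (h : size z ≤ 2 ^ n / 2) : φ.low (n + 2) z = 1 := by
  refine φ.eq_one _ ?_
  rw [size_dil, inv_mul_le_iff₀ (by positivity)]
  linarith

theorem of_low_ne_zero {n : ℕ} {z : Phase d} (h : φ.low n z ≠ 0) :
    2 ≤ n ∧ size z ≤ 2 ^ n / 6 := by
  match n with
  | 0 => exact absurd rfl h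
  | 1 => exact absurd rfl h
  | n + 2 =>
    refine ⟨by omega, ?_⟩
    by_contra! hc
    refine h (φ.eq_zero _ ?_)
    rw [size_dil, lt_inv_mul_iff₀ (by positivity)]
    rw [pow_add] at hc
    linarith

/-- No radial monotonicity of the cutoff is assumed. Where `low n` is nonzero, the size is at most
`2 ^ n / 6`, and there `low (n + 1)` is already `1`. -/
theorem low_le_succ (n : ℕ) (z : Phase d) : φ.low n z ≤ φ.low (n + 1) z := by
  by_cases h : φ.low n z = 0
  · rw [h]; exact φ.low_nonneg _ _
  · obtain ⟨h2, hs⟩ := φ.of_low_ne_zero h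
    obtain ⟨m, rfl⟩ := Nat.exists_eq_add_of_le' h2
    have : φ.low (m + 1 + 2) z = 1 := by
      apply φ.low_eq_one
      have : (0 : ℝ) < 2 ^ m := by positivity
      rw [pow_add] at hs ⊢
      linarith
    rw [show m + 2 + 1 = m + 1 + 2 by omega, this]
    exact φ.low_le_one _ _

theorem low_mono (z : Phase d) : Monotone fun n => φ.low n z :=
  monotone_nat_of_le_succ fun n => φ.low_le_succ n z

theorem piece_eq (n : ℕ) (z : Phase d) : φ.piece n z = φ.low (n + 2) z - φ.low (n + 1) z := by
  match n with
  | 0 => simp [piece, low, dil_zero]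
  | n + 1 => rfl

theorem piece_nonneg (n : ℕ) (z : Phase d) : 0 ≤ φ.piece n z := by
  rw [piece_eq]; exact sub_nonneg.2 (φ.low_le_succ _ _)

theorem near_nonneg (n : ℕ) (z : Phase d) : 0 ≤ φ.near n z :=
  sub_nonneg.2 (φ.low_mono z (by omega))

theorem near_le_one (n : ℕ) (z : Phase d) : φ.near n z ≤ 1 := by
  have := φ.low_nonneg n z
  have := φ.low_le_one (n + 3) z
  unfold near; linarith

theorem piece_le_near (n : ℕ) (z : Phase d) : φ.piece n z ≤ φ.near n z := by
  rw [piece_eq, near]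
  have := φ.low_le_succ n z
  have := φ.low_le_succ (n + 2) z
  linarith

theorem piece_le_one (n : ℕ) (z : Phase d) : φ.piece n z ≤ 1 :=
  (φ.piece_le_near n z).trans (φ.near_le_one n z)

theorem of_piece_ne_zero {n : ℕ} {z : Phase d} (h : φ.piece n z ≠ 0) :
    size z ≤ 2 / 3 * 2 ^ n ∧ (n = 0 ∨ 2 ^ n / 4 < size z) := by
  rw [piece_eq] at h
  constructor
  · have h1 : φ.low (n + 2) z ≠ 0 := by
      intro h0
      have h2 := φ.low_le_succ (n + 1) z
      have h3 := φ.low_nonneg (n + 1) z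
      have : φ.low (n + 1) z = 0 := le_antisymm (h2.trans_eq h0) h3
      exact h (by rw [h0, this, sub_zero])
    have := (φ.of_low_ne_zero h1).2
    rw [pow_add] at this
    linarith
  · rcases n with _ | n
    · exact Or.inl rfl
    · right
      by_contra! hc
      have h1 : φ.low (n + 2) z = 1 := by
        apply φ.low_eq_one; rw [pow_succ] at hc; linarith
      have h2 : φ.low (n + 1 + 2) z = 1 :=
        le_antisymm (φ.low_le_one _ _) (h1 ▸ φ.low_le_succ (n + 2) z)
      exact h (by rw [h2, show n + 1 + 1 = n + 2 by omega, h1, sub_self])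

theorem near_eq_one_of_size {j : ℕ} {z : Phase d} (h1 : size z ≤ 2 ^ j)
    (h2 : j < 2 ∨ 2 ^ j / 6 < size z) : φ.near j z = 1 := by
  have h3 : φ.low j z = 0 := by
    by_contra hc
    obtain ⟨h4, h5⟩ := φ.of_low_ne_zero hc
    rcases h2 with h2 | h2
    · omega
    · linarith
  have h4 : φ.low (j + 1 + 2) z = 1 := by
    apply φ.low_eq_one; rw [pow_succ]; linarith
  rw [near, h3, show j + 3 = j + 1 + 2 by omega, h4, sub_zero]

theorem near_eq_one {j : ℕ} {z : Phase d} (h : φ.piece j z ≠ 0) : φ.near j z = 1 := by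
  obtain ⟨h1, h2⟩ := φ.of_piece_ne_zero h
  have : (0 : ℝ) < 2 ^ j := by positivity
  exact φ.near_eq_one_of_size (by linarith) (h2.imp (by omega) (by intro; linarith))

theorem piece_mul_near (j : ℕ) (z : Phase d) : φ.piece j z * φ.near j z = φ.piece j z := by
  by_cases h : φ.piece j z = 0
  · simp [h]
  · rw [φ.near_eq_one h, mul_one]

/-- A low-frequency perturbation of a point in the `j`-th annulus stays near that annulus. -/
theorem near_sub_eq_one {j n : ℕ} {y z : Phase d} (hy : φ.piece j y ≠ 0) (hz : φ.piece n z ≠ 0)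
    (hnj : n + 4 ≤ j) : φ.near j (y - z) = 1 := by
  obtain ⟨h1, h2⟩ := φ.of_piece_ne_zero hy
  obtain ⟨h3, -⟩ := φ.of_piece_ne_zero hz
  have h4 : (2 : ℝ) ^ n * 16 ≤ 2 ^ j := by
    have : (2 : ℝ) ^ (n + 4) ≤ 2 ^ j := pow_le_pow_right₀ (by norm_num) hnj
    rw [pow_add] at this
    linarith
  have h5 : size (y - z) ≤ size y + size z := by
    rw [sub_eq_add_neg, ← size_neg z]; exact size_add_le _ _
  have h6 : size y ≤ size (y - z) + size z := by
    simpa using size_add_le (y - z) z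
  have h7 : (0 : ℝ) < 2 ^ n := by positivity
  -- The gap of four scales gives `size z ≤ 2 ^ j / 24`; then `2/3 + 1/24 ≤ 1` and `1/4 - 1/24 >
  -- 1/6`.
  refine φ.near_eq_one_of_size (by linarith) (Or.inr ?_)
  rcases h2 with h2 | h2
  · omega
  · linarith

/-- Telescoping with step three leaves three top cutoffs, each at most `1`. -/
theorem sum_near_le (N : ℕ) (z : Phase d) : ∑ n ∈ Finset.range N, φ.near n z ≤ 3 := by
  have h : ∑ n ∈ Finset.range N, φ.near n z =
      φ.low N z + φ.low (N + 1) z + φ.low (N + 2) z - φ.low 0 z - φ.low 1 z - φ.low 2 z := by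
    induction N with
    | zero => rw [Finset.sum_range_zero]; ring
    | succ N ih => rw [Finset.sum_range_succ, ih, near]; ring
  have h0 := φ.low_nonneg 0 z
  have h1 := φ.low_nonneg 1 z
  have h2 := φ.low_nonneg 2 z
  have h3 := φ.low_le_one N z
  have h4 := φ.low_le_one (N + 1) z
  have h5 := φ.low_le_one (N + 2) z
  linarith

theorem sum_near_sq_le (N : ℕ) (z : Phase d) : ∑ n ∈ Finset.range N, φ.near n z ^ 2 ≤ 3 :=
  (Finset.sum_le_sum fun n _ => by
    nlinarith [φ.near_nonneg n z, φ.near_le_one n z]).trans (φ.sum_near_le N z)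

/-- On the support of `near n` with `n ≥ 2`, `size z > 2 ^ n / 8`. Hence `2 ^ (2n) ≤ 64 * size z ^ 2
≤ 128 * weight z`; for `n < 2` this follows from `weight z ≥ 1`. -/
theorem two_rpow_mul_near_le {s : ℝ} (hs : 0 ≤ s) (n : ℕ) (z : Phase d) :
    ((2 : ℝ) ^ (s * n)) ^ 2 * φ.near n z ≤ 128 ^ s * weight z ^ s * φ.near n z := by
  by_cases h : φ.near n z = 0
  · simp [h]
  refine mul_le_mul_of_nonneg_right ?_ (φ.near_nonneg n z)
  have h1 : ((2 : ℝ) ^ n) ^ 2 ≤ 128 * weight z := by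
    have hw := one_le_weight z
    have hs := size_sq_le z
    match n with
    | 0 => norm_num; linarith
    | 1 => norm_num; linarith
    | n + 2 =>
      have h2 : ¬ size z ≤ 2 ^ n / 2 := by
        intro hc
        have h3 := φ.low_eq_one n z hc
        have h4 : φ.low (n + 2) z ≤ φ.low (n + 2 + 3) z := φ.low_mono z (by omega)
        have h5 := φ.low_le_one (n + 2 + 3) z
        refine h ?_
        rw [near]; linarith
      push Not at h2
      have h3 : (2 : ℝ) ^ (n + 2) < 8 * size z := by rw [pow_add]; linarith
      have : (0 : ℝ) < 2 ^ (n + 2) := by positivity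
      nlinarith
  calc ((2 : ℝ) ^ (s * n)) ^ 2 = (((2 : ℝ) ^ n) ^ 2) ^ s := by
        rw [← Real.rpow_natCast, ← Real.rpow_natCast, ← Real.rpow_natCast,
          ← Real.rpow_mul (by norm_num), ← Real.rpow_mul (by norm_num), ← Real.rpow_mul (by norm_num)]
        ring_nf
    _ ≤ (128 * weight z) ^ s := Real.rpow_le_rpow (by positivity) h1 hs
    _ = _ := Real.mul_rpow (by norm_num) (by linarith [one_le_weight z])

theorem sum_near_weight_le {s : ℝ} (hs : 0 ≤ s) (N : ℕ) (z : Phase d) :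
    ∑ n ∈ Finset.range N, ((2 : ℝ) ^ (s * n)) ^ 2 * φ.near n z ^ 2 ≤
      3 * 128 ^ s * weight z ^ s := by
  have hw : 0 ≤ (128 : ℝ) ^ s * weight z ^ s := by
    have := one_le_weight z
    positivity
  calc ∑ n ∈ Finset.range N, ((2 : ℝ) ^ (s * n)) ^ 2 * φ.near n z ^ 2
      ≤ ∑ n ∈ Finset.range N, 128 ^ s * weight z ^ s * φ.near n z := by
        refine Finset.sum_le_sum fun n _ => (le_trans ?_ (φ.two_rpow_mul_near_le hs n z))
        refine mul_le_mul_of_nonneg_left ?_ (by positivity)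
        nlinarith [φ.near_nonneg n z, φ.near_le_one n z]
    _ = 128 ^ s * weight z ^ s * ∑ n ∈ Finset.range N, φ.near n z := by rw [Finset.mul_sum]
    _ ≤ 128 ^ s * weight z ^ s * 3 := mul_le_mul_of_nonneg_left (φ.sum_near_le N z) hw
    _ = _ := by ring

theorem weight_mul_piece_le {s : ℝ} (hs : 0 ≤ s) (n : ℕ) (z : Phase d) :
    weight z ^ s * φ.piece n z ^ 2 ≤ 2 ^ s * (((2 : ℝ) ^ (s * n)) ^ 2 * φ.piece n z ^ 2) := by
  by_cases h : φ.piece n z = 0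
  · simp [h]
  rw [← mul_assoc]
  refine mul_le_mul_of_nonneg_right ?_ (sq_nonneg _)
  have h1 : weight z ≤ 2 * ((2 : ℝ) ^ n) ^ 2 := by
    have h2 := (φ.of_piece_ne_zero h).1
    have h3 : (1 : ℝ) ≤ 2 ^ n := one_le_pow₀ (by norm_num)
    have h4 := weight_le z
    nlinarith [size_nonneg z]
  calc weight z ^ s ≤ (2 * ((2 : ℝ) ^ n) ^ 2) ^ s :=
        Real.rpow_le_rpow (by linarith [one_le_weight z]) h1 hs
    _ = 2 ^ s * (((2 : ℝ) ^ n) ^ 2) ^ s := Real.mul_rpow (by norm_num) (by positivity)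
    _ = _ := by
        rw [← Real.rpow_natCast, ← Real.rpow_natCast, ← Real.rpow_natCast,
          ← Real.rpow_mul (by norm_num), ← Real.rpow_mul (by norm_num), ← Real.rpow_mul (by norm_num)]
        ring_nf

/-- For the least `n` with `size z ≤ 2 ^ n`, the sum telescopes to `low (n + 3) - low (n + 1) = 1 -
0`. -/
theorem exists_piece_add_eq_one (z : Phase d) : ∃ n, φ.piece n z + φ.piece (n + 1) z = 1 := by
  classical
  have hex : ∃ n : ℕ, size z ≤ 2 ^ n :=
    (pow_unbounded_of_one_lt (size z) (by norm_num : (1 : ℝ) < 2)).imp fun _ h => h.le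
  refine ⟨Nat.find hex, ?_⟩
  set n := Nat.find hex with hn
  have h1 : φ.low (n + 1 + 2) z = 1 := by
    apply φ.low_eq_one
    rw [pow_succ]
    linarith [Nat.find_spec hex]
  have h2 : φ.low (n + 1) z = 0 := by
    by_contra hc
    obtain ⟨h3, h4⟩ := φ.of_low_ne_zero hc
    have h5 : ¬ size z ≤ 2 ^ (n - 1) := Nat.find_min hex (by omega)
    obtain ⟨m, hm⟩ : ∃ m, n = m + 1 := ⟨n - 1, by omega⟩
    rw [hm] at h4 h5
    rw [Nat.add_sub_cancel] at h5
    rw [pow_add, pow_add] at h4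
    have : (0 : ℝ) < 2 ^ m := by positivity
    exact h5 (by linarith)
  rw [piece_eq, piece_eq, h2, show n + 1 + 1 = n + 2 by omega, h1]
  ring

theorem weight_le_sum {s : ℝ} (hs : 0 ≤ s) (z : Phase d) :
    ∃ N, weight z ^ s ≤
      2 * 2 ^ s * ∑ n ∈ Finset.range N, ((2 : ℝ) ^ (s * n)) ^ 2 * φ.piece n z ^ 2 := by
  obtain ⟨n, hn⟩ := φ.exists_piece_add_eq_one z
  refine ⟨n + 2, ?_⟩
  have hw : 0 ≤ weight z ^ s := Real.rpow_nonneg (by linarith [one_le_weight z]) _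
  have h1 := φ.weight_mul_piece_le hs n z
  have h2 := φ.weight_mul_piece_le hs (n + 1) z
  -- If `a + b = 1` then `a ^ 2 + b ^ 2 ≥ 1/2`: this is the factor `2` in the constant.
  have h3 : 1 ≤ 2 * (φ.piece n z ^ 2 + φ.piece (n + 1) z ^ 2) := by
    nlinarith [sq_nonneg (φ.piece n z - φ.piece (n + 1) z)]
  have h4 : 0 ≤ ∑ m ∈ Finset.range n, ((2 : ℝ) ^ (s * m)) ^ 2 * φ.piece m z ^ 2 :=
    Finset.sum_nonneg fun _ _ => by positivity
  have h5 : (0 : ℝ) < 2 ^ s := by positivity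
  rw [Finset.sum_range_succ, Finset.sum_range_succ]
  nlinarith [mul_le_mul_of_nonneg_left h3 hw, mul_nonneg h5.le h4]

end Cutoff

end Kinetic

/-! ### Convergence of the dyadic decomposition in the space of tempered distributions -/

/-- Multiplying a Schwartz function by symbols with uniformly bounded derivatives that vanish on
balls with radii tending to infinity gives a null sequence. -/
theorem SchwartzMap.tendsto_smulLeftCLM_zero {E : Type*} [NormedAddCommGroup E] [NormedSpace ℝ E]
    (b : ℕ → E → ℂ) (R : ℕ → ℝ) (hb : ∀ N, (b N).HasTemperateGrowth)
    (hR : Filter.Tendsto R Filter.atTop Filter.atTop)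
    (hbd : ∀ i : ℕ, ∃ C, ∀ N x, ‖iteratedFDeriv ℝ i (b N) x‖ ≤ C)
    (hz : ∀ N x, ‖x‖ < R N → b N x = 0) (ψ : 𝓢(E, ℂ)) :
    Filter.Tendsto (fun N => SchwartzMap.smulLeftCLM ℂ (b N) ψ) Filter.atTop (nhds 0) := by
  rw [(schwartz_withSeminorms ℝ E ℂ).tendsto_nhds]
  rintro ⟨k, n⟩ ε hε
  choose C hC using hbd
  set K : ℝ := ∑ i ∈ Finset.range (n + 1), (n.choose i : ℝ) * |C i| *
    SchwartzMap.seminorm ℝ (k + 1) (n - i) ψ with hK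
  have hK0 : 0 ≤ K := Finset.sum_nonneg fun i _ => by positivity
  filter_upwards [hR.eventually_gt_atTop ((K + 1) / ε), hR.eventually_gt_atTop 0] with N hN hN0
  rw [sub_zero, schwartzSeminormFamily_apply]
  -- Where the symbol is not locally zero, `‖x‖ ≥ R N`, so one extra power of `‖x‖` in the seminorm
  -- buys a factor `1 / R N`.
  refine lt_of_le_of_lt (b := K / R N) ?_ ?_
  · refine SchwartzMap.seminorm_le_bound ℝ k n _ (by positivity) fun x => ?_
    have hfun : (⇑(SchwartzMap.smulLeftCLM ℂ (b N) ψ) : E → ℂ) = fun x => b N x • ψ x := by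
      ext x; exact SchwartzMap.smulLeftCLM_apply_apply (hb N) ψ x
    rw [hfun]
    rcases lt_or_ge ‖x‖ (R N) with hx | hx
    · have h0 : (fun x => b N x • ψ x) =ᶠ[nhds x] fun _ => (0 : ℂ) := by
        filter_upwards [(isOpen_lt continuous_norm continuous_const).mem_nhds hx] with y hy
        rw [hz N y hy, zero_smul]
      have h1 : iteratedFDeriv ℝ n (fun x => b N x • ψ x) x = 0 := by
        rw [(Filter.EventuallyEq.iteratedFDeriv ℝ h0 n).eq_of_nhds]
        simp
      rw [h1, norm_zero, mul_zero]
      positivity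
    · have h1 := norm_iteratedFDeriv_smul_le (𝕜 := ℝ) (hb N).1
        (ψ.smooth ⊤) x (n := n) (by exact_mod_cast le_top)
      rw [le_div_iff₀ hN0]
      calc ‖x‖ ^ k * ‖iteratedFDeriv ℝ n (fun x => b N x • ψ x) x‖ * R N
          ≤ ‖x‖ ^ k * ‖iteratedFDeriv ℝ n (fun x => b N x • ψ x) x‖ * ‖x‖ := by gcongr
        _ = ‖x‖ ^ (k + 1) * ‖iteratedFDeriv ℝ n (fun x => b N x • ψ x) x‖ := by ring
        _ ≤ ‖x‖ ^ (k + 1) * ∑ i ∈ Finset.range (n + 1), (n.choose i : ℝ) *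
            ‖iteratedFDeriv ℝ i (b N) x‖ * ‖iteratedFDeriv ℝ (n - i) ψ x‖ := by gcongr
        _ = ∑ i ∈ Finset.range (n + 1), (n.choose i : ℝ) *
            ‖iteratedFDeriv ℝ i (b N) x‖ * (‖x‖ ^ (k + 1) * ‖iteratedFDeriv ℝ (n - i) ψ x‖) := by
            rw [Finset.mul_sum]; refine Finset.sum_congr rfl fun i _ => by ring
        _ ≤ K := by
            refine Finset.sum_le_sum fun i _ => ?_
            gcongr
            · exact (hC i N x).trans (le_abs_self _)
            · exact SchwartzMap.le_seminorm ℝ (k + 1) (n - i) ψ x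
  · rw [div_lt_iff₀ hN0]
    rw [div_lt_iff₀ hε] at hN
    linarith

namespace Kinetic

variable {d : ℕ}

theorem norm_dil_le (j : ℕ) (z : Phase d) : ‖dil j z‖ ≤ ‖z‖ := by
  have h1 : pos (dil j z) = ((2 : ℝ) ^ (3 * j))⁻¹ • pos z := by ext i; simp [pos, dil]
  have h2 : vel (dil j z) = ((2 : ℝ) ^ j)⁻¹ • vel z := by ext i; simp [vel, dil]
  have h3 : ‖pos (dil j z)‖ ≤ ‖pos z‖ := by
    rw [h1, norm_smul, Real.norm_of_nonneg (by positivity)]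
    exact mul_le_of_le_one_left (norm_nonneg _) (inv_le_one_of_one_le₀ (one_le_pow₀ (by norm_num)))
  have h4 : ‖vel (dil j z)‖ ≤ ‖vel z‖ := by
    rw [h2, norm_smul, Real.norm_of_nonneg (by positivity)]
    exact mul_le_of_le_one_left (norm_nonneg _) (inv_le_one_of_one_le₀ (one_le_pow₀ (by norm_num)))
  rw [norm_eq_sqrt, norm_eq_sqrt z]
  gcongr

/-- The linear map `z ↦ dil j (2π z)`. -/
def dilL (d j : ℕ) : Phase d →L[ℝ] Phase d :=
  LinearMap.mkContinuous
    { toFun := fun z => dil j ((2 * π) • z)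
      map_add' := fun a b => by rw [smul_add, dil_add]
      map_smul' := fun a b => by rw [smul_comm, dil_smul, RingHom.id_apply] } (2 * π) fun z => by
    refine (norm_dil_le j _).trans_eq ?_
    rw [norm_smul, Real.norm_of_nonneg (by positivity)]

theorem norm_dilL_le (d j : ℕ) : ‖dilL d j‖ ≤ 2 * π :=
  LinearMap.mkContinuous_norm_le _ (by positivity) _

namespace Cutoff

variable (φ : Cutoff d)

/-- The symbol of the low-frequency projection, for Mathlib's Fourier transform. -/
def lowSym (n : ℕ) (z : Phase d) : ℂ := (φ.low n ((2 * π) • z) : ℝ)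

theorem contDiff_ofReal : ContDiff ℝ ∞ fun z => (φ.toFun z : ℂ) :=
  Complex.ofRealCLM.contDiff.comp φ.contDiff

theorem hasCompactSupport_ofReal : HasCompactSupport fun z => (φ.toFun z : ℂ) :=
  φ.hasCompactSupport.comp_left (g := fun x : ℝ => (x : ℂ)) Complex.ofReal_zero

theorem lowSym_eq_comp (n : ℕ) :
    φ.lowSym (n + 2) = (fun z => (φ.toFun z : ℂ)) ∘ dilL d n := rfl

theorem hasTemperateGrowth_lowSym (n : ℕ) : (φ.lowSym n).HasTemperateGrowth := by
  match n with
  | 0 =>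
    have : φ.lowSym 0 = fun _ => 0 := by ext z; simp [lowSym, low]
    rw [this]; exact Function.HasTemperateGrowth.const _
  | 1 =>
    have : φ.lowSym 1 = fun _ => 0 := by ext z; simp [lowSym, low]
    rw [this]; exact Function.HasTemperateGrowth.const _
  | n + 2 =>
    rw [lowSym_eq_comp]
    exact (φ.hasCompactSupport_ofReal.hasTemperateGrowth φ.contDiff_ofReal).comp
      (dilL d n).hasTemperateGrowth

/-- Uniformity in `n` comes from `norm_dilL_le`: the dilations do not expand, so each derivative
costs at most `2π`. -/
theorem norm_iteratedFDeriv_lowSym_le (i : ℕ) :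
    ∃ C, ∀ n x, ‖iteratedFDeriv ℝ i (φ.lowSym (n + 2)) x‖ ≤ C := by
  obtain ⟨C, hC⟩ := (φ.hasCompactSupport_ofReal.iteratedFDeriv (𝕜 := ℝ) i).exists_bound_of_continuous
    (φ.contDiff_ofReal.continuous_iteratedFDeriv (by exact_mod_cast le_top))
  refine ⟨C * (2 * π) ^ i, fun n x => ?_⟩
  rw [lowSym_eq_comp, ContinuousLinearMap.iteratedFDeriv_comp_right (n := ∞) _ φ.contDiff_ofReal _
    (by exact_mod_cast le_top)]
  refine (ContinuousMultilinearMap.norm_compContinuousLinearMap_le _ _).trans ?_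
  rw [Finset.prod_const, Finset.card_univ, Fintype.card_fin]
  have h0 : 0 ≤ C := (norm_nonneg _).trans (hC 0)
  exact mul_le_mul (hC _) (pow_le_pow_left₀ (norm_nonneg _) (norm_dilL_le d n) i) (by positivity) h0

theorem tendsto_smulLeftCLM_lowSym (ψ : 𝓢(Phase d, ℂ)) :
    Filter.Tendsto (fun n => SchwartzMap.smulLeftCLM ℂ (φ.lowSym (n + 2)) ψ) Filter.atTop
      (nhds ψ) := by
  have hone : (fun _ : Phase d => (1 : ℂ)).HasTemperateGrowth := Function.HasTemperateGrowth.const _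
  -- Inside this radius `‖2πx‖ ≤ 2 ^ n / 4`, hence the size is at most `2 ^ n / 2`. The `-1` makes a
  -- nonempty ball force `2 ^ n / 4 ≥ 1`, as `size_le_of_norm_le` requires.
  have key := SchwartzMap.tendsto_smulLeftCLM_zero
    (fun n => (fun _ => (1 : ℂ)) - φ.lowSym (n + 2)) (fun n => (2 : ℝ) ^ n / (8 * π) - 1)
    (fun n => hone.sub (φ.hasTemperateGrowth_lowSym _)) ?_ ?_ ?_ ψ
  · have h2 : ∀ n, SchwartzMap.smulLeftCLM ℂ (φ.lowSym (n + 2)) ψ =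
        ψ - SchwartzMap.smulLeftCLM ℂ ((fun _ => (1 : ℂ)) - φ.lowSym (n + 2)) ψ := by
      intro n
      rw [SchwartzMap.smulLeftCLM_sub hone (φ.hasTemperateGrowth_lowSym _)]
      simp
    simp_rw [h2]
    simpa using key.const_sub ψ
  · refine Filter.tendsto_atTop_add_const_right _ _ (Filter.Tendsto.atTop_div_const (by positivity) ?_)
    exact tendsto_pow_atTop_atTop_of_one_lt (by norm_num)
  · intro i
    obtain ⟨C, hC⟩ := φ.norm_iteratedFDeriv_lowSym_le i
    refine ⟨1 + C, fun n x => ?_⟩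
    rw [iteratedFDeriv_sub_apply contDiff_const.contDiffAt
      ((φ.hasTemperateGrowth_lowSym _).1.of_le (by exact_mod_cast le_top)).contDiffAt]
    refine (norm_sub_le _ _).trans (add_le_add ?_ (hC n x))
    rcases i with _ | i
    · simp
    · rw [iteratedFDeriv_const_of_ne (by omega)]; simp
  · intro n x hx
    have hR : ‖(2 * π) • x‖ ≤ max 1 (2 ^ n / 4) := by
      rw [norm_smul, Real.norm_of_nonneg (by positivity)]
      refine le_max_of_le_right ?_
      have h1 : ‖x‖ ≤ (2 : ℝ) ^ n / (8 * π) := by linarith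
      calc 2 * π * ‖x‖ ≤ 2 * π * ((2 : ℝ) ^ n / (8 * π)) := by gcongr
        _ = _ := by field_simp; norm_num
    have hn : (1 : ℝ) ≤ 2 ^ n / 4 := by
      have h1 : (1 : ℝ) < 2 ^ n / (8 * π) := by linarith [norm_nonneg x]
      rw [lt_div_iff₀ (by positivity)] at h1
      linarith [Real.pi_gt_three]
    have h1 : φ.low (n + 2) ((2 * π) • x) = 1 := by
      apply φ.low_eq_one
      rw [max_eq_right hn] at hR
      linarith [size_le_of_norm_le _ hn hR]
    simp [lowSym, h1]

theorem piece_symbol_eq (n : ℕ) :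
    (fun z : Phase d => ((φ.piece n ((2 * π) • z) : ℝ) : ℂ)) =
      φ.lowSym (n + 2) - φ.lowSym (n + 1) := by
  ext z; simp [piece_eq, lowSym]

theorem sum_block (N : ℕ) (T : 𝓢'(Phase d, ℂ)) (ψ : 𝓢(Phase d, ℂ)) :
    ∑ n ∈ Finset.range N, φ.block n T ψ =
      T (𝓕 (SchwartzMap.smulLeftCLM ℂ (φ.lowSym (N + 1)) (𝓕⁻ ψ))) := by
  induction N with
  | zero =>
    have : φ.lowSym 1 = fun _ => 0 := by ext z; simp [lowSym, low]
    simp [this]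
  | succ N ih =>
    rw [Finset.sum_range_succ, ih, block, TemperedDistribution.fourierMultiplierCLM_apply_apply,
      piece_symbol_eq, SchwartzMap.smulLeftCLM_sub (φ.hasTemperateGrowth_lowSym _)
      (φ.hasTemperateGrowth_lowSym _), ← map_add, ← FourierTransform.fourier_add]
    simp

/-- A tempered distribution is the sum of its dyadic blocks. -/
theorem tendsto_sum_block (T : 𝓢'(Phase d, ℂ)) (ψ : 𝓢(Phase d, ℂ)) :
    Filter.Tendsto (fun N => ∑ n ∈ Finset.range N, φ.block n T ψ) Filter.atTop (nhds (T ψ)) := by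
  rw [← Filter.tendsto_add_atTop_iff_nat 1]
  simp_rw [sum_block]
  have h1 := φ.tendsto_smulLeftCLM_lowSym (𝓕⁻ ψ)
  have h2 : Continuous fun u : 𝓢(Phase d, ℂ) => T (𝓕 u) :=
    T.continuous.comp (FourierTransform.fourierCLM ℂ 𝓢(Phase d, ℂ)).continuous
  have h3 := (h2.tendsto _).comp h1
  simpa [Function.comp_def] using h3

end Cutoff

/-! ### Representation of tempered distributions by functions -/

/-- Uniqueness makes the infima in `distLpNorm` and `sobolevNorm` range over a single a.e. class. -/
theorem IsRepresentedBy.ae_eq {T : 𝓢'(Phase d, ℂ)} {u v : Phase d → ℂ} (hu : IsRepresentedBy T u)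
    (hv : IsRepresentedBy T v) : u =ᵐ[volume] v := by
  refine ae_eq_of_integral_contDiff_smul_eq hu.1 hv.1 fun g hg hgc => ?_
  have hg₁ : HasCompactSupport (Complex.ofRealCLM ∘ g) := hgc.comp_left rfl
  have hg₂ : ContDiff ℝ ∞ (Complex.ofRealCLM ∘ g) := by fun_prop
  have h1 := (hu.2 (hg₁.toSchwartzMap hg₂)).2
  have h2 := (hv.2 (hg₁.toSchwartzMap hg₂)).2
  simpa using h1.symm.trans h2

theorem IsRepresentedBy.congr {T : 𝓢'(Phase d, ℂ)} {u v : Phase d → ℂ} (hu : IsRepresentedBy T u)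
    (h : u =ᵐ[volume] v) : IsRepresentedBy T v := by
  refine ⟨hu.1.congr h, fun ψ => ?_⟩
  have h1 : (fun z => ψ z * u z) =ᵐ[volume] fun z => ψ z * v z := by
    filter_upwards [h] with z hz
    rw [hz]
  exact ⟨(hu.2 ψ).1.congr h1, (hu.2 ψ).2.trans (integral_congr_ae h1)⟩

theorem isRepresentedBy_toTemperedDistribution {p : ℝ≥0∞} [hp : Fact (1 ≤ p)]
    (U : Lp ℂ p (volume : Measure (Phase d))) :
    IsRepresentedBy (Lp.toTemperedDistribution U) U := by
  refine ⟨(Lp.memLp U).locallyIntegrable hp.out, fun ψ => ⟨?_, ?_⟩⟩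
  · have := ENNReal.HolderConjugate.inv_one_sub_inv' hp.out
    exact (Lp.memLp U).integrable_mul (p := p) (q := (1 - p⁻¹)⁻¹) (ψ.memLp _ _) |>.congr
      (Filter.Eventually.of_forall fun z => mul_comm _ _)
  · simp [Lp.toTemperedDistribution_apply]

theorem IsRepresentedBy.toTemperedDistribution_toLp {T : 𝓢'(Phase d, ℂ)} {p : ℝ≥0∞}
    [hp : Fact (1 ≤ p)] {u : Phase d → ℂ} (hu : IsRepresentedBy T u) (h : MemLp u p volume) :
    Lp.toTemperedDistribution (h.toLp u) = T := by
  ext ψ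
  rw [(hu.2 ψ).2, Lp.toTemperedDistribution_apply]
  refine integral_congr_ae ?_
  filter_upwards [h.coeFn_toLp] with z hz
  rw [hz, smul_eq_mul]

theorem exists_toTemperedDistribution_eq {T : 𝓢'(Phase d, ℂ)} {p : ℝ≥0∞} [hp : Fact (1 ≤ p)]
    (h : distLpNorm p T < ⊤) : ∃ U : Lp ℂ p (volume : Measure (Phase d)),
      Lp.toTemperedDistribution U = T ∧ ‖U‖ₑ ≤ distLpNorm p T := by
  simp only [distLpNorm, iInf_lt_iff] at h
  obtain ⟨u, hu, hlt⟩ := h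
  have hm : MemLp u p volume := ⟨hu.1.aestronglyMeasurable, hlt⟩
  refine ⟨hm.toLp u, hu.toTemperedDistribution_toLp hm, le_iInf₂ fun v hv => ?_⟩
  rw [Lp.enorm_def, eLpNorm_congr_ae hm.coeFn_toLp, eLpNorm_congr_ae (hu.ae_eq hv)]

theorem distLpNorm_toTemperedDistribution_le {p : ℝ≥0∞} [hp : Fact (1 ≤ p)]
    (U : Lp ℂ p (volume : Measure (Phase d))) :
    distLpNorm p (Lp.toTemperedDistribution U) ≤ ‖U‖ₑ :=
  iInf₂_le_of_le _ (isRepresentedBy_toTemperedDistribution U) (Lp.enorm_def U).ge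

theorem toTemperedDistribution_injective {p : ℝ≥0∞} [hp : Fact (1 ≤ p)]
    {U V : Lp ℂ p (volume : Measure (Phase d))}
    (h : Lp.toTemperedDistribution U = Lp.toTemperedDistribution V) : U = V := by
  have h1 := isRepresentedBy_toTemperedDistribution U
  rw [h] at h1
  exact Lp.ext (h1.ae_eq (isRepresentedBy_toTemperedDistribution V))

/-! ### Multiplication by symbols with values in `[0, 1]` -/

/-- The space `L²` on phase space. -/
abbrev L2 (d : ℕ) := Lp ℂ 2 (volume : Measure (Phase d))

/-- The space `L^∞` on phase space. -/
abbrev Linf (d : ℕ) := Lp ℂ ⊤ (volume : Measure (Phase d))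

/-- Multiplication `L^∞ × L² → L²`. -/
def mulL (d : ℕ) : Linf d →L[ℂ] L2 d →L[ℂ] L2 d :=
  (ContinuousLinearMap.lsmul ℂ ℂ).holderL volume ⊤ 2 2

theorem coeFn_mulL (G : Linf d) (F : L2 d) : mulL d G F =ᵐ[volume] fun z => G z * F z :=
  Lp.coeFn_lpSMul G F

theorem norm_mulL_le (G : Linf d) (F : L2 d) : ‖mulL d G F‖ ≤ ‖G‖ * ‖F‖ :=
  Lp.norm_smul_le G F

/-- A symbol of temperate growth with values in `[0, 1]`. -/
structure UnitSymbol (d : ℕ) where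
  toFun : Phase d → ℝ
  growth : (fun z => (toFun z : ℂ)).HasTemperateGrowth
  nonneg : ∀ z, 0 ≤ toFun z
  le_one : ∀ z, toFun z ≤ 1

namespace UnitSymbol

variable (a : UnitSymbol d)

/-- The complex-valued symbol. -/
def sym (z : Phase d) : ℂ := (a.toFun z : ℂ)

theorem sym_growth : a.sym.HasTemperateGrowth := a.growth

theorem norm_sym (z : Phase d) : ‖a.sym z‖ = a.toFun z := by
  rw [sym, Complex.norm_real, Real.norm_of_nonneg (a.nonneg z)]

theorem memLp : MemLp a.sym ⊤ (volume : Measure (Phase d)) :=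
  memLp_top_of_bound a.sym_growth.1.continuous.aestronglyMeasurable 1
    (Filter.Eventually.of_forall fun z => (a.norm_sym z).trans_le (a.le_one z))

/-- Multiplication by the symbol on `L²`. -/
def mul : L2 d →L[ℂ] L2 d := mulL d (a.memLp.toLp a.sym)

theorem coeFn_mul (u : L2 d) : a.mul u =ᵐ[volume] fun z => a.sym z * u z := by
  filter_upwards [coeFn_mulL (a.memLp.toLp a.sym) u, a.memLp.coeFn_toLp] with z h1 h2
  rw [mul, h1, h2]

theorem enorm_mul_sq (u : L2 d) :
    ‖a.mul u‖ₑ ^ 2 = ∫⁻ z, ENNReal.ofReal (a.toFun z ^ 2) * ‖u z‖ₑ ^ 2 := by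
  rw [Lp.enorm_def, eLpNorm_eq_lintegral_rpow_enorm_toReal (by norm_num) (by norm_num)]
  rw [← ENNReal.rpow_natCast, ← ENNReal.rpow_mul]
  norm_num
  refine lintegral_congr_ae ?_
  filter_upwards [a.coeFn_mul u] with z hz
  rw [hz, enorm_mul, mul_pow, ← ofReal_norm, a.norm_sym, ENNReal.ofReal_pow (a.nonneg z)]

theorem norm_mul_le (u : L2 d) : ‖a.mul u‖ ≤ ‖u‖ := by
  refine Lp.norm_le_norm_of_ae_le ?_
  filter_upwards [a.coeFn_mul u] with z hz
  rw [hz, norm_mul, a.norm_sym]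
  exact mul_le_of_le_one_left (norm_nonneg _) (a.le_one z)

theorem mul_toLp (ψ : 𝓢(Phase d, ℂ)) :
    a.mul (ψ.toLp 2) = (SchwartzMap.smulLeftCLM ℂ a.sym ψ).toLp 2 := by
  refine Lp.ext ?_
  filter_upwards [a.coeFn_mul (ψ.toLp 2), ψ.coeFn_toLp 2,
    (SchwartzMap.smulLeftCLM ℂ a.sym ψ).coeFn_toLp 2] with z h1 h2 h3
  rw [h1, h2, h3, SchwartzMap.smulLeftCLM_apply_apply a.sym_growth, smul_eq_mul]

theorem toTemperedDistribution_mul (u : L2 d) :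
    (Lp.toTemperedDistribution (a.mul u) : 𝓢'(Phase d, ℂ)) =
      TemperedDistribution.smulLeftCLM ℂ a.sym (Lp.toTemperedDistribution u) :=
  Lp.toTemperedDistribution_smul_eq a.sym_growth a.memLp u

/-- The Fourier multiplier on `L²` with the given symbol. -/
def mult : L2 d →L[ℂ] L2 d :=
  (FourierTransform.fourierInvCLM ℂ (L2 d)) ∘L a.mul ∘L (FourierTransform.fourierCLM ℂ (L2 d))

theorem mult_apply (F : L2 d) : a.mult F = 𝓕⁻ (a.mul (𝓕 F)) := rfl

theorem norm_fourierInv (F : L2 d) : ‖(𝓕⁻ F : L2 d)‖ = ‖F‖ := by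
  rw [← Lp.norm_fourier_eq, FourierTransform.fourier_fourierInv_eq]

theorem norm_mult (F : L2 d) : ‖a.mult F‖ = ‖a.mul (𝓕 F)‖ := by
  rw [mult_apply, norm_fourierInv]

theorem norm_mult_le (F : L2 d) : ‖a.mult F‖ ≤ ‖F‖ := by
  rw [norm_mult, ← Lp.norm_fourier_eq F]; exact a.norm_mul_le _

/-- Identifies the Plancherel multiplier on `L²` with the distributional one, so block estimates can
be made in `L²`. -/
theorem toTemperedDistribution_mult (F : L2 d) :
    (Lp.toTemperedDistribution (a.mult F) : 𝓢'(Phase d, ℂ)) =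
      TemperedDistribution.fourierMultiplierCLM ℂ a.sym (Lp.toTemperedDistribution F) := by
  rw [mult_apply, ← Lp.fourierInv_toTemperedDistribution_eq, toTemperedDistribution_mul,
    ← Lp.fourier_toTemperedDistribution_eq]
  rfl

/-- The complementary symbol. -/
def compl : UnitSymbol d where
  toFun z := 1 - a.toFun z
  growth := by
    have h : (fun z => ((1 - a.toFun z : ℝ) : ℂ)) = (fun _ => (1 : ℂ)) - a.sym := by
      ext z; simp [sym]
    rw [h]
    exact (Function.HasTemperateGrowth.const _).sub a.sym_growth
  nonneg z := sub_nonneg.2 (a.le_one z)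
  le_one z := sub_le_self _ (a.nonneg z)

theorem mul_add_compl (u : L2 d) : a.mul u + a.compl.mul u = u := by
  refine Lp.ext ?_
  filter_upwards [Lp.coeFn_add (a.mul u) (a.compl.mul u), a.coeFn_mul u, a.compl.coeFn_mul u]
    with z h1 h2 h3
  rw [h1, Pi.add_apply, h2, h3]
  simp only [sym, compl]
  push_cast
  ring

theorem mult_add_compl (F : L2 d) : a.mult F + a.compl.mult F = F := by
  rw [mult_apply, mult_apply, ← FourierTransform.fourierInv_add, mul_add_compl,
    FourierTransform.fourierInv_fourier_eq]

end UnitSymbol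

namespace Cutoff

variable (φ : Cutoff d)

/-- The symbol of the block operator. -/
def pieceSym (n : ℕ) : UnitSymbol d where
  toFun z := φ.piece n ((2 * π) • z)
  growth := φ.hasTemperateGrowth_symbol n
  nonneg _ := φ.piece_nonneg _ _
  le_one _ := φ.piece_le_one _ _

/-- The symbol of the fattened block operator. -/
def nearSym (n : ℕ) : UnitSymbol d where
  toFun z := φ.near n ((2 * π) • z)
  growth := by
    have h : (fun z => ((φ.near n ((2 * π) • z) : ℝ) : ℂ)) = φ.lowSym (n + 3) - φ.lowSym n := by
      ext z; simp [near, lowSym]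
    rw [h]
    exact (φ.hasTemperateGrowth_lowSym _).sub (φ.hasTemperateGrowth_lowSym _)
  nonneg _ := φ.near_nonneg _ _
  le_one _ := φ.near_le_one _ _

theorem block_toTemperedDistribution (n : ℕ) (F : L2 d) :
    φ.block n (Lp.toTemperedDistribution F) = Lp.toTemperedDistribution ((φ.pieceSym n).mult F) :=
  ((φ.pieceSym n).toTemperedDistribution_mult F).symm

theorem block_apply (n : ℕ) (T : 𝓢'(Phase d, ℂ)) (ψ : 𝓢(Phase d, ℂ)) :
    φ.block n T ψ = T (𝓕 (SchwartzMap.smulLeftCLM ℂ (φ.pieceSym n).sym (𝓕⁻ ψ))) := rfl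

end Cutoff

end Kinetic

/-! ### Frequency supports of products -/

/-- The inverse Fourier transform of `𝓕⁻ b · 𝓕 a` is the correlation of `a` and `b`. -/
theorem SchwartzMap.fourierInv_smulLeftCLM_fourier_apply {V : Type*} [NormedAddCommGroup V]
    [InnerProductSpace ℝ V] [FiniteDimensional ℝ V] [MeasurableSpace V] [BorelSpace V]
    (a b : 𝓢(V, ℂ)) (z : V) :
    (𝓕⁻ (SchwartzMap.smulLeftCLM ℂ (𝓕⁻ b : 𝓢(V, ℂ)) (𝓕 a)) : 𝓢(V, ℂ)) z =
      ∫ y, a y * b (y - z) := by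
  set c : 𝓢(V, ℂ) := 𝓕⁻ (SchwartzMap.compSubConstCLM ℂ z b) with hc
  have h1 : ∀ x, c x = 𝐞 (inner ℝ x z) • (𝓕⁻ b : 𝓢(V, ℂ)) x := by
    intro x
    rw [hc, SchwartzMap.fourierInv_coe, SchwartzMap.fourierInv_coe, Real.fourierInv_eq,
      Real.fourierInv_eq, ← integral_sub_right_eq_self _ (-z)]
    simp only [Circle.smul_def]
    rw [← integral_smul]
    refine integral_congr_ae (Filter.Eventually.of_forall fun y => ?_)
    simp only [SchwartzMap.compSubConstCLM_apply, sub_neg_eq_add, add_sub_cancel_right,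
      inner_add_left, AddChar.map_add_eq_mul, Circle.coe_mul, smul_eq_mul, real_inner_comm x z]
    ring
  have h2 : (𝓕 c : 𝓢(V, ℂ)) = SchwartzMap.compSubConstCLM ℂ z b :=
    FourierTransform.fourier_fourierInv_eq _
  have h3 := SchwartzMap.integral_fourier_mul_eq a c
  rw [h2] at h3
  simp only [SchwartzMap.compSubConstCLM_apply] at h3
  rw [← h3, SchwartzMap.fourierInv_coe, Real.fourierInv_eq]
  refine integral_congr_ae (Filter.Eventually.of_forall fun x => ?_)
  simp only [h1, SchwartzMap.smulLeftCLM_apply_apply (SchwartzMap.hasTemperateGrowth _),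
    Circle.smul_def, smul_eq_mul]
  ring

namespace Kinetic

variable {d : ℕ}

theorem toTemperedDistribution_mulL_toLp (G : Linf d) (b : 𝓢(Phase d, ℂ)) (ψ : 𝓢(Phase d, ℂ)) :
    Lp.toTemperedDistribution (mulL d G (b.toLp 2)) ψ =
      Lp.toTemperedDistribution G (SchwartzMap.smulLeftCLM ℂ b ψ) := by
  rw [Lp.toTemperedDistribution_apply, Lp.toTemperedDistribution_apply]
  refine integral_congr_ae ?_
  filter_upwards [coeFn_mulL G (b.toLp 2), b.coeFn_toLp 2] with z h1 h2
  rw [h1, h2, SchwartzMap.smulLeftCLM_apply_apply b.hasTemperateGrowth]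
  simp only [smul_eq_mul]
  ring

namespace Cutoff

variable (φ : Cutoff d)

/-- Multiplication by a function of low frequency does not move a function supported away from an
annulus into that annulus. -/
theorem mult_mulL_mult_eq_zero {T : 𝓢'(Phase d, ℂ)} {j n : ℕ} (hnj : n + 4 ≤ j) {G : Linf d}
    (hG : Lp.toTemperedDistribution G = φ.block n T) (F : L2 d) :
    (φ.pieceSym j).mult (mulL d G ((φ.nearSym j).compl.mult F)) = 0 := by
  set p := φ.pieceSym j with hp
  set q := (φ.nearSym j).compl with hq
  -- For Schwartz `b` and a Schwartz test function `a`, everything can be moved onto the argument of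
  -- `T`, where the supports are explicit.
  have key : ∀ b : 𝓢(Phase d, ℂ),
      p.mul (𝓕 (mulL d G (𝓕⁻ (q.mul (b.toLp 2))))) = 0 := by
    intro b
    refine toTemperedDistribution_injective ?_
    ext a
    rw [p.toTemperedDistribution_mul, TemperedDistribution.smulLeftCLM_apply_apply,
      ← Lp.fourier_toTemperedDistribution_eq, TemperedDistribution.fourier_apply, q.mul_toLp,
      SchwartzMap.toLp_fourierInv_eq, toTemperedDistribution_mulL_toLp, hG, block_apply]
    -- At `z` the inner function is `∫ y, (p a)(y) (q b)(y - z)`. If `z` meets the `n`-th piece and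
    -- `y` the `j`-th, then `near j (y - z) = 1`, so `q` vanishes at `y - z`.
    have h0 : SchwartzMap.smulLeftCLM ℂ (φ.pieceSym n).sym
        (𝓕⁻ (SchwartzMap.smulLeftCLM ℂ (𝓕⁻ (SchwartzMap.smulLeftCLM ℂ q.sym b) : 𝓢(Phase d, ℂ))
          (𝓕 (SchwartzMap.smulLeftCLM ℂ p.sym a)))) = 0 := by
      ext z
      rw [SchwartzMap.smulLeftCLM_apply_apply (φ.pieceSym n).sym_growth,
        SchwartzMap.fourierInv_smulLeftCLM_fourier_apply]
      by_cases hz : φ.piece n ((2 * π) • z) = 0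
      · simp [UnitSymbol.sym, pieceSym, hz]
      · have : ∀ y, SchwartzMap.smulLeftCLM ℂ p.sym a y *
            SchwartzMap.smulLeftCLM ℂ q.sym b (y - z) = 0 := by
          intro y
          rw [SchwartzMap.smulLeftCLM_apply_apply p.sym_growth,
            SchwartzMap.smulLeftCLM_apply_apply q.sym_growth]
          by_cases hy : φ.piece j ((2 * π) • y) = 0
          · simp [UnitSymbol.sym, hp, pieceSym, hy]
          · have := φ.near_sub_eq_one hy hz hnj
            rw [← smul_sub] at this
            simp [UnitSymbol.sym, hq, UnitSymbol.compl, nearSym, this]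
        simp [this]
    rw [h0, FourierTransform.fourier_zero]
    simp [Lp.toTemperedDistribution_apply]
  have hdense := SchwartzMap.denseRange_toLpCLM (E := Phase d) (F := ℂ) (p := 2)
    (μ := volume) (by norm_num)
  have hall : ∀ u : L2 d, p.mul (𝓕 (mulL d G (𝓕⁻ (q.mul u)))) = 0 := by
    intro u
    refine hdense.induction_on (p := fun u => p.mul (𝓕 (mulL d G (𝓕⁻ (q.mul u)))) = 0) u ?_ key
    refine isClosed_eq ?_ continuous_const
    exact (p.mul ∘L (FourierTransform.fourierCLM ℂ (L2 d)) ∘L mulL d G ∘L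
      (FourierTransform.fourierInvCLM ℂ (L2 d)) ∘L q.mul).continuous
  rw [UnitSymbol.mult_apply, UnitSymbol.mult_apply, hall, FourierTransform.fourierInv_zero]

end Cutoff

/-! ### Equivalence of the dyadic and the weighted norms -/

/-- The squared weighted `L²` norm of the Fourier transform. -/
def weightSq (s : ℝ) (F : L2 d) : ℝ≥0∞ :=
  ∫⁻ z, ENNReal.ofReal (weight ((2 * π) • z) ^ s) * ‖(𝓕 F : L2 d) z‖ₑ ^ 2

/-- The weighted square sum of the pieces of `F` cut out by a sequence of Fourier multipliers. -/
def dyadicSq (s : ℝ) (a : ℕ → UnitSymbol d) (F : L2 d) : ℝ≥0∞ :=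
  ∑' n : ℕ, ENNReal.ofReal (((2 : ℝ) ^ (s * n)) ^ 2) * ‖(a n).mult F‖ₑ ^ 2

theorem UnitSymbol.enorm_mult_sq (a : UnitSymbol d) (F : L2 d) :
    ‖a.mult F‖ₑ ^ 2 = ∫⁻ z, ENNReal.ofReal (a.toFun z ^ 2) * ‖(𝓕 F : L2 d) z‖ₑ ^ 2 := by
  rw [← a.enorm_mul_sq, ← ofReal_norm, a.norm_mult, ofReal_norm]

theorem UnitSymbol.measurable_sq (a : UnitSymbol d) :
    Measurable fun z => ENNReal.ofReal (a.toFun z ^ 2) := by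
  have h : Continuous a.toFun := by
    have := Complex.continuous_re.comp a.sym_growth.1.continuous
    simpa [UnitSymbol.sym, Function.comp_def] using this
  exact ((h.pow 2).measurable).ennreal_ofReal

theorem aemeasurable_enorm_sq (u : L2 d) : AEMeasurable (fun z => ‖u z‖ₑ ^ 2) volume :=
  (Lp.aestronglyMeasurable u).enorm.pow_const 2

/-- Plancherel and Tonelli reduce comparisons of norms to pointwise comparisons of symbols. -/
theorem dyadicSq_eq (s : ℝ) (a : ℕ → UnitSymbol d) (F : L2 d) :
    dyadicSq s a F = ∫⁻ z, (∑' n : ℕ, ENNReal.ofReal (((2 : ℝ) ^ (s * n)) ^ 2 *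
      (a n).toFun z ^ 2)) * ‖(𝓕 F : L2 d) z‖ₑ ^ 2 := by
  simp_rw [← ENNReal.tsum_mul_right]
  rw [lintegral_tsum]
  · refine tsum_congr fun n => ?_
    rw [UnitSymbol.enorm_mult_sq, ← lintegral_const_mul' _ _ ENNReal.ofReal_ne_top]
    refine lintegral_congr fun z => ?_
    rw [ENNReal.ofReal_mul (by positivity), mul_assoc]
  · intro n
    simp_rw [ENNReal.ofReal_mul (sq_nonneg ((2 : ℝ) ^ (s * (n : ℝ))))]
    exact ((a n).measurable_sq.const_mul _).aemeasurable.mul (aemeasurable_enorm_sq _)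

theorem enorm_sq_eq (u : L2 d) : ‖u‖ₑ ^ 2 = ∫⁻ z, ‖u z‖ₑ ^ 2 := by
  rw [Lp.enorm_def, eLpNorm_eq_lintegral_rpow_enorm_toReal (by norm_num) (by norm_num),
    ← ENNReal.rpow_natCast, ← ENNReal.rpow_mul]
  norm_num

theorem enorm_sq_le_weightSq {s : ℝ} (hs : 0 ≤ s) (F : L2 d) : ‖F‖ₑ ^ 2 ≤ weightSq s F := by
  rw [← ofReal_norm, ← Lp.norm_fourier_eq, ofReal_norm, enorm_sq_eq]
  refine lintegral_mono fun z => ?_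
  have h1 : (1 : ℝ≥0∞) ≤ ENNReal.ofReal (weight ((2 * π) • z) ^ s) := by
    rw [← ENNReal.ofReal_one]
    exact ENNReal.ofReal_le_ofReal (Real.one_le_rpow (one_le_weight _) hs)
  simpa using mul_le_mul_left h1 (‖(𝓕 F : L2 d) z‖ₑ ^ 2)

namespace Cutoff

variable (φ : Cutoff d)

theorem dyadicSq_near_le {s : ℝ} (hs : 0 ≤ s) (F : L2 d) :
    dyadicSq s φ.nearSym F ≤ ENNReal.ofReal (3 * 128 ^ s) * weightSq s F := by
  rw [dyadicSq_eq, weightSq, ← lintegral_const_mul' _ _ ENNReal.ofReal_ne_top]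
  refine lintegral_mono fun z => ?_
  dsimp only
  rw [← mul_assoc]
  refine mul_le_mul_left (ENNReal.tsum_le_of_sum_range_le fun N => ?_) _
  rw [← ENNReal.ofReal_sum_of_nonneg fun _ _ => by positivity, ← ENNReal.ofReal_mul (by positivity)]
  exact ENNReal.ofReal_le_ofReal (φ.sum_near_weight_le hs N _)

theorem weightSq_le {s : ℝ} (hs : 0 ≤ s) (F : L2 d) :
    weightSq s F ≤ ENNReal.ofReal (2 * 2 ^ s) * dyadicSq s φ.pieceSym F := by
  rw [dyadicSq_eq, weightSq, ← lintegral_const_mul' _ _ ENNReal.ofReal_ne_top]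
  refine lintegral_mono fun z => ?_
  dsimp only
  rw [← mul_assoc]
  refine mul_le_mul_left ?_ _
  obtain ⟨N, hN⟩ := φ.weight_le_sum hs ((2 * π) • z)
  calc ENNReal.ofReal (weight ((2 * π) • z) ^ s)
      ≤ ENNReal.ofReal (2 * 2 ^ s * ∑ n ∈ Finset.range N,
          ((2 : ℝ) ^ (s * n)) ^ 2 * (φ.pieceSym n).toFun z ^ 2) := ENNReal.ofReal_le_ofReal hN
    _ = ENNReal.ofReal (2 * 2 ^ s) * ∑ n ∈ Finset.range N,
          ENNReal.ofReal (((2 : ℝ) ^ (s * n)) ^ 2 * (φ.pieceSym n).toFun z ^ 2) := by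
        rw [ENNReal.ofReal_mul (by positivity), ENNReal.ofReal_sum_of_nonneg fun _ _ => by positivity]
    _ ≤ _ := by gcongr; exact ENNReal.sum_le_tsum _

/-- Almost orthogonality of the fattened blocks. -/
theorem sum_norm_near_mul_sq_le (N : ℕ) (u : L2 d) :
    ∑ n ∈ Finset.range N, ‖(φ.nearSym n).mul u‖ ^ 2 ≤ 3 * ‖u‖ ^ 2 := by
  have h3 : (3 : ℝ≥0∞) = ENNReal.ofReal 3 := (ENNReal.ofReal_ofNat 3).symm
  have h : ∑ n ∈ Finset.range N, ‖(φ.nearSym n).mul u‖ₑ ^ 2 ≤ 3 * ‖u‖ₑ ^ 2 := by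
    simp_rw [UnitSymbol.enorm_mul_sq]
    rw [← lintegral_finsetSum' (Finset.range N)
      (f := fun n z => ENNReal.ofReal ((φ.nearSym n).toFun z ^ 2) * ‖u z‖ₑ ^ 2) fun n _ =>
      (φ.nearSym n).measurable_sq.aemeasurable.mul (aemeasurable_enorm_sq u), enorm_sq_eq,
      ← lintegral_const_mul' _ _ (by norm_num)]
    refine lintegral_mono fun z => ?_
    dsimp only
    rw [← Finset.sum_mul, ← ENNReal.ofReal_sum_of_nonneg fun _ _ => by positivity]
    refine mul_le_mul_left ?_ _
    rw [h3]
    exact ENNReal.ofReal_le_ofReal (φ.sum_near_sq_le N _)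
  simp_rw [← ofReal_norm, ← ENNReal.ofReal_pow (norm_nonneg _)] at h
  rw [← ENNReal.ofReal_sum_of_nonneg fun _ _ => by positivity, h3,
    ← ENNReal.ofReal_mul (by norm_num)] at h
  exact (ENNReal.ofReal_le_ofReal_iff (by positivity)).1 h

end Cutoff

/-! ### The Sobolev and Besov norms of `L²` functions -/

/-- The Jacobian factor relating the two normalisations of the Fourier transform. -/
def jac (d : ℕ) : ℝ≥0∞ := ENNReal.ofReal ((2 * π) ^ Module.finrank ℝ (Phase d))

theorem lintegral_comp_inv_two_pi_smul (h : Phase d → ℝ≥0∞) :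
    ∫⁻ z, h ((2 * π)⁻¹ • z) = jac d * ∫⁻ z, h z := by
  have h0 : (2 * π)⁻¹ ≠ 0 := by positivity
  have h1 := Measure.map_addHaar_smul (volume : Measure (Phase d)) h0
  have h2 : ∫⁻ z, h ((2 * π)⁻¹ • z) =
      ∫⁻ z, h z ∂(Measure.map ((2 * π)⁻¹ • ·) (volume : Measure (Phase d))) :=
    (lintegral_map_equiv h (Homeomorph.smulOfNeZero _ h0).toMeasurableEquiv).symm
  rw [h2, h1, lintegral_smul_measure, smul_eq_mul, jac]
  congr 2
  rw [inv_pow, inv_inv, abs_of_nonneg (by positivity)]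

/-- The change of normalisation contributes only the factor `jac d`, which is the same on both sides
of the final estimate. -/
theorem sobolevNorm_toTemperedDistribution (s : ℝ) (F : L2 d) :
    sobolevNorm s (Lp.toTemperedDistribution F) = (jac d * weightSq s F) ^ (1 / 2 : ℝ) := by
  have hF : IsRepresentedBy (𝓕 (Lp.toTemperedDistribution F : 𝓢'(Phase d, ℂ))) (𝓕 F : L2 d) := by
    rw [Lp.fourier_toTemperedDistribution_eq]
    exact isRepresentedBy_toTemperedDistribution _
  have key : ∀ u : Phase d → ℂ,
      IsRepresentedBy (𝓕 (Lp.toTemperedDistribution F : 𝓢'(Phase d, ℂ))) u →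
      ∫⁻ z : Phase d, ENNReal.ofReal ((1 + ‖pos z‖ ^ (2 / 3 : ℝ) + ‖vel z‖ ^ 2) ^ s) *
        ‖u ((2 * π)⁻¹ • z)‖ₑ ^ 2 = jac d * weightSq s F := by
    intro u hu
    have h1 := lintegral_comp_inv_two_pi_smul
      (fun z : Phase d => ENNReal.ofReal (weight ((2 * π) • z) ^ s) * ‖u z‖ₑ ^ 2)
    have h2 : ∫⁻ z : Phase d, ENNReal.ofReal (weight ((2 * π) • z) ^ s) * ‖u z‖ₑ ^ 2 =
        weightSq s F := by
      refine lintegral_congr_ae ?_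
      filter_upwards [hu.ae_eq hF] with z hz
      rw [hz]
    rw [← h2, ← h1]
    refine lintegral_congr fun z => ?_
    rw [smul_inv_smul₀ (by positivity)]
    rfl
  refine le_antisymm (iInf₂_le_of_le _ hF ?_) (le_iInf₂ fun u hu => ?_)
  · rw [key _ hF]
  · rw [key _ hu]

theorem distLpNorm_toTemperedDistribution {p : ℝ≥0∞} [hp : Fact (1 ≤ p)]
    (U : Lp ℂ p (volume : Measure (Phase d))) :
    distLpNorm p (Lp.toTemperedDistribution U : 𝓢'(Phase d, ℂ)) = ‖U‖ₑ := by
  refine le_antisymm (distLpNorm_toTemperedDistribution_le U) (le_iInf₂ fun v hv => ?_)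
  rw [Lp.enorm_def, eLpNorm_congr_ae ((isRepresentedBy_toTemperedDistribution U).ae_eq hv)]

theorem two_rpow_eq_ofReal (x : ℝ) : (2 : ℝ≥0∞) ^ x = ENNReal.ofReal ((2 : ℝ) ^ x) := by
  rw [← ENNReal.ofReal_rpow_of_pos (by norm_num), ENNReal.ofReal_ofNat]

/-- Membership in the Sobolev space in terms of the square sum of the blocks. -/
theorem memSobolev_iff (φ : Cutoff d) (s : ℝ) (T : 𝓢'(Phase d, ℂ)) :
    MemSobolev φ s T ↔ ∑' n : ℕ, ENNReal.ofReal (((2 : ℝ) ^ (s * n)) ^ 2) *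
      distLpNorm 2 (φ.block n T) ^ 2 < ⊤ := by
  have h : ∀ n : ℕ, ENNReal.ofReal (((2 : ℝ) ^ (s * n)) ^ 2) * distLpNorm 2 (φ.block n T) ^ 2 =
      ENNReal.ofReal (((2 : ℝ) ^ s) ^ 2) *
      ((2 : ℝ≥0∞) ^ (s * ((n : ℝ) - 1)) * distLpNorm 2 (φ.block n T)) ^ (2 : ℝ≥0∞).toReal := by
    intro n
    rw [two_rpow_eq_ofReal, ENNReal.toReal_ofNat, ENNReal.rpow_ofNat, mul_pow, ← mul_assoc,
      ← ENNReal.ofReal_pow (by positivity), ← ENNReal.ofReal_mul (by positivity), ← mul_pow,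
      ← Real.rpow_add (by norm_num)]
    ring_nf
  simp_rw [h]
  rw [ENNReal.tsum_mul_left, MemSobolev, besovNorm, if_neg (by norm_num),
    ENNReal.rpow_lt_top_iff_of_pos (by norm_num)]
  constructor
  · exact fun h => ENNReal.mul_lt_top ENNReal.ofReal_lt_top h
  · intro h
    refine ENNReal.lt_top_of_mul_ne_top_right h.ne ?_
    simp only [ne_eq, ENNReal.ofReal_eq_zero, not_le]
    positivity

theorem memSobolev_toTemperedDistribution_iff (φ : Cutoff d) (s : ℝ) (F : L2 d) :
    MemSobolev φ s (Lp.toTemperedDistribution F) ↔ dyadicSq s φ.pieceSym F < ⊤ := by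
  rw [memSobolev_iff]
  simp_rw [φ.block_toTemperedDistribution, distLpNorm_toTemperedDistribution]
  rfl

/-! ### Block estimates for the product -/

namespace Cutoff

variable (φ : Cutoff d)

theorem summable_of_norm_le_geometric {G : ℕ → Linf d} {K ρ : ℝ} (hρ0 : 0 < ρ) (hρ1 : ρ < 1)
    (hn : ∀ n, ‖G n‖ ≤ K * ρ ^ n) : Summable G :=
  Summable.of_norm_bounded ((summable_geometric_of_lt_one hρ0.le hρ1).mul_left K) hn

/-- The part of the second factor away from the `j`-th annulus contributes only through the
high-frequency blocks of the first factor. -/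
theorem norm_mult_mulL_compl_le {T : 𝓢'(Phase d, ℂ)} {G : ℕ → Linf d} {K ρ : ℝ}
    (hG : ∀ n, Lp.toTemperedDistribution (G n) = φ.block n T) (hK : 0 ≤ K) (hρ0 : 0 < ρ)
    (hρ1 : ρ < 1) (hn : ∀ n, ‖G n‖ ≤ K * ρ ^ n) (F : L2 d) (j : ℕ) :
    ‖(φ.pieceSym j).mult (mulL d (∑' n, G n) ((φ.nearSym j).compl.mult F))‖ ≤
      K / (1 - ρ) / ρ ^ 3 * (ρ ^ j * ‖F‖) := by
  have hsum : Summable G := summable_of_norm_le_geometric hρ0 hρ1 hn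
  have hgeo : HasSum (fun n => K * ρ ^ n) (K / (1 - ρ)) := by
    simpa [div_eq_mul_inv] using (hasSum_geometric_of_lt_one hρ0.le hρ1).mul_left K
  have hKρ : 0 ≤ K / (1 - ρ) := div_nonneg hK (sub_pos.2 hρ1).le
  have h1 : HasSum
      (fun n => (φ.pieceSym j).mult (mulL d (G n) ((φ.nearSym j).compl.mult F)))
      ((φ.pieceSym j).mult (mulL d (∑' n, G n) ((φ.nearSym j).compl.mult F))) :=
    hsum.hasSum.mapL ((φ.pieceSym j).mult ∘L (mulL d).flip ((φ.nearSym j).compl.mult F))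
  -- The blocks with `n < j - 3` vanish. For `j ≤ 3` the truncated subtraction discards none.
  have h2 : HasSum
      (fun n => (φ.pieceSym j).mult (mulL d (G (n + (j - 3))) ((φ.nearSym j).compl.mult F)))
      ((φ.pieceSym j).mult (mulL d (∑' n, G n) ((φ.nearSym j).compl.mult F))) := by
    have h := (hasSum_nat_add_iff' (j - 3)).2 h1
    rwa [Finset.sum_eq_zero, sub_zero] at h
    intro n hnj
    rw [Finset.mem_range] at hnj
    exact φ.mult_mulL_mult_eq_zero (by omega) (hG n) F
  have h3 : ∀ n,
      ‖(φ.pieceSym j).mult (mulL d (G (n + (j - 3))) ((φ.nearSym j).compl.mult F))‖ ≤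
        K * ρ ^ n * (ρ ^ (j - 3) * ‖F‖) := by
    intro n
    refine ((φ.pieceSym j).norm_mult_le _).trans ((norm_mulL_le _ _).trans ?_)
    refine (mul_le_mul (hn _) ((φ.nearSym j).compl.norm_mult_le F) (norm_nonneg _)
      (mul_nonneg hK (pow_nonneg hρ0.le _))).trans_eq ?_
    rw [pow_add]; ring
  have h4 : ρ ^ (j - 3) ≤ ρ ^ j / ρ ^ 3 := by
    rw [le_div_iff₀ (by positivity), ← pow_add]
    exact pow_le_pow_of_le_one hρ0.le hρ1.le (by omega)
  rw [← h2.tsum_eq]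
  refine (tsum_of_norm_bounded (hgeo.mul_right _) h3).trans ?_
  refine (mul_le_mul_of_nonneg_left (mul_le_mul_of_nonneg_right h4 (norm_nonneg _)) hKρ).trans_eq ?_
  ring

/-- Each block of a product is controlled by the nearby blocks of one factor, up to an error that
decays at the rate given by the regularity of the other factor. -/
theorem norm_mult_mulL_tsum_le {T : 𝓢'(Phase d, ℂ)} {G : ℕ → Linf d} {K ρ : ℝ}
    (hG : ∀ n, Lp.toTemperedDistribution (G n) = φ.block n T) (hK : 0 ≤ K) (hρ0 : 0 < ρ)
    (hρ1 : ρ < 1) (hn : ∀ n, ‖G n‖ ≤ K * ρ ^ n) (F : L2 d) (j : ℕ) :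
    ‖(φ.pieceSym j).mult (mulL d (∑' n, G n) F)‖ ≤
      K / (1 - ρ) / ρ ^ 3 * (‖(φ.nearSym j).mult F‖ + ρ ^ j * ‖F‖) := by
  have hgeo : HasSum (fun n => K * ρ ^ n) (K / (1 - ρ)) := by
    simpa [div_eq_mul_inv] using (hasSum_geometric_of_lt_one hρ0.le hρ1).mul_left K
  have hKρ : 0 ≤ K / (1 - ρ) := div_nonneg hK (sub_pos.2 hρ1).le
  -- Enlarged by `1 / ρ ^ 3 ≥ 1` so that the near and far parts share one constant.
  have hnormG : ‖∑' n, G n‖ ≤ K / (1 - ρ) / ρ ^ 3 :=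
    (tsum_of_norm_bounded hgeo hn).trans
      (le_div_self hKρ (by positivity) (pow_le_one₀ hρ0.le hρ1.le))
  have hnear : ‖(φ.pieceSym j).mult (mulL d (∑' n, G n) ((φ.nearSym j).mult F))‖ ≤
      K / (1 - ρ) / ρ ^ 3 * ‖(φ.nearSym j).mult F‖ :=
    ((φ.pieceSym j).norm_mult_le _).trans
      ((norm_mulL_le _ _).trans (mul_le_mul_of_nonneg_right hnormG (norm_nonneg _)))
  have hfar := φ.norm_mult_mulL_compl_le hG hK hρ0 hρ1 hn F j
  have hsplit : (φ.pieceSym j).mult (mulL d (∑' n, G n) F) =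
      (φ.pieceSym j).mult (mulL d (∑' n, G n) ((φ.nearSym j).mult F)) +
      (φ.pieceSym j).mult (mulL d (∑' n, G n) ((φ.nearSym j).compl.mult F)) := by
    rw [← map_add, ← map_add, (φ.nearSym j).mult_add_compl]
  rw [hsplit, mul_add]
  exact (norm_add_le _ _).trans (add_le_add hnear hfar)

theorem sq_le_of_le_mul_add {x N f A c ρ : ℝ} (hx : 0 ≤ x) (hN : 0 ≤ N) (hf : 0 ≤ f)
    (h : x ≤ A * (N + ρ * f)) :
    ENNReal.ofReal (c ^ 2) * ENNReal.ofReal x ^ 2 ≤ ENNReal.ofReal (2 * A ^ 2) *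
      (ENNReal.ofReal (c ^ 2) * ENNReal.ofReal N ^ 2 +
        ENNReal.ofReal (c ^ 2 * ρ ^ 2) * ENNReal.ofReal f ^ 2) := by
  rw [← ENNReal.ofReal_pow hx, ← ENNReal.ofReal_pow hN, ← ENNReal.ofReal_pow hf,
    ← ENNReal.ofReal_mul (by positivity), ← ENNReal.ofReal_mul (by positivity),
    ← ENNReal.ofReal_mul (by positivity), ← ENNReal.ofReal_add (by positivity) (by positivity),
    ← ENNReal.ofReal_mul (by positivity)]
  refine ENNReal.ofReal_le_ofReal ?_
  have h3 : x ^ 2 ≤ 2 * A ^ 2 * (N ^ 2 + ρ ^ 2 * f ^ 2) := by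
    refine (pow_le_pow_left₀ hx h 2).trans ?_
    nlinarith [mul_nonneg (sq_nonneg A) (sq_nonneg (N - ρ * f))]
  calc c ^ 2 * x ^ 2 ≤ c ^ 2 * (2 * A ^ 2 * (N ^ 2 + ρ ^ 2 * f ^ 2)) := by gcongr
    _ = _ := by ring

/-- Squaring and summing the block bound gives two series: the near one is controlled by finite
overlap, and the error is geometric with ratio `(2 ^ s * ρ) ^ 2` times `‖F‖ ^ 2`. -/
theorem dyadicSq_mulL_tsum_le {T : 𝓢'(Phase d, ℂ)} {G : ℕ → Linf d} {K ρ s : ℝ}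
    (hG : ∀ n, Lp.toTemperedDistribution (G n) = φ.block n T) (hK : 0 ≤ K) (hρ0 : 0 < ρ)
    (hρ1 : ρ < 1) (hn : ∀ n, ‖G n‖ ≤ K * ρ ^ n) (hs : 0 ≤ s) (hκ : 2 ^ s * ρ < 1) (F : L2 d) :
    dyadicSq s φ.pieceSym (mulL d (∑' n, G n) F) ≤
      ENNReal.ofReal (2 * (K / (1 - ρ) / ρ ^ 3) ^ 2 *
        (3 * 128 ^ s + (1 - (2 ^ s * ρ) ^ 2)⁻¹)) * weightSq s F := by
  have hκ2 : (2 ^ s * ρ) ^ 2 < 1 := pow_lt_one₀ (by positivity) hκ (by norm_num)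
  have hterm : ∀ j : ℕ, ENNReal.ofReal (((2 : ℝ) ^ (s * j)) ^ 2) *
      ‖(φ.pieceSym j).mult (mulL d (∑' n, G n) F)‖ₑ ^ 2 ≤
        ENNReal.ofReal (2 * (K / (1 - ρ) / ρ ^ 3) ^ 2) *
        (ENNReal.ofReal (((2 : ℝ) ^ (s * j)) ^ 2) * ‖(φ.nearSym j).mult F‖ₑ ^ 2 +
          ENNReal.ofReal (((2 ^ s * ρ) ^ 2) ^ j) * ‖F‖ₑ ^ 2) := by
    intro j
    have h1 := φ.norm_mult_mulL_tsum_le hG hK hρ0 hρ1 hn F j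
    have h2 : ((2 ^ s * ρ) ^ 2) ^ j = ((2 : ℝ) ^ (s * j)) ^ 2 * (ρ ^ j) ^ 2 := by
      rw [Real.rpow_mul (by norm_num), Real.rpow_natCast]; ring
    simp_rw [← ofReal_norm]
    rw [h2]
    exact sq_le_of_le_mul_add (norm_nonneg _) (norm_nonneg _) (norm_nonneg _) h1
  have hgeo : ∑' j : ℕ, ENNReal.ofReal (((2 ^ s * ρ) ^ 2) ^ j) =
      ENNReal.ofReal ((1 - (2 ^ s * ρ) ^ 2)⁻¹) := by
    rw [← ENNReal.ofReal_tsum_of_nonneg (fun j => by positivity)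
      (summable_geometric_of_lt_one (by positivity) hκ2),
      tsum_geometric_of_lt_one (by positivity) hκ2]
  have h1κ : 0 ≤ (1 - (2 ^ s * ρ) ^ 2)⁻¹ := inv_nonneg.2 (sub_pos.2 hκ2).le
  refine (ENNReal.tsum_le_tsum hterm).trans ?_
  rw [ENNReal.tsum_mul_left, ENNReal.tsum_add, ENNReal.tsum_mul_right, hgeo,
    ENNReal.ofReal_mul (p := 2 * (K / (1 - ρ) / ρ ^ 3) ^ 2) (by positivity), mul_assoc, ENNReal.ofReal_add (by positivity) h1κ, add_mul]
  refine mul_le_mul_right (add_le_add (φ.dyadicSq_near_le hs F) ?_) _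
  exact mul_le_mul_right (enorm_sq_le_weightSq hs F) _

/-! ### Sobolev distributions are `L²` functions -/

theorem norm_toTemperedDistribution_apply_le (U : L2 d) (ψ : 𝓢(Phase d, ℂ)) :
    ‖Lp.toTemperedDistribution U ψ‖ ≤ ‖U‖ * ‖ψ.toLp 2 (volume : Measure (Phase d))‖ := by
  -- The pairing is bilinear, whereas the inner product is conjugate-linear in its first slot; hence
  -- `star`.
  have h : Lp.toTemperedDistribution U ψ = inner ℂ (star U) (ψ.toLp 2 volume) := by
    rw [Lp.toTemperedDistribution_apply, L2.inner_def]
    refine integral_congr_ae ?_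
    filter_upwards [Lp.coeFn_star U, ψ.coeFn_toLp 2] with z h1 h2
    rw [h1, h2]
    simp
  have hstar : ‖star U‖ = ‖U‖ := by
    rw [Lp.norm_def, Lp.norm_def, eLpNorm_congr_ae (Lp.coeFn_star U), eLpNorm_star]
  rw [h, ← hstar]
  exact norm_inner_le_norm _ _

/-- Since `piece * near = piece`, a fattened block can be put on the test function; this allows
Cauchy–Schwarz over `n`. -/
theorem block_eq_block_near (n : ℕ) (T : 𝓢'(Phase d, ℂ)) (ψ : 𝓢(Phase d, ℂ)) :
    φ.block n T ψ =
      φ.block n T (𝓕 (SchwartzMap.smulLeftCLM ℂ (φ.nearSym n).sym (𝓕⁻ ψ))) := by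
  rw [block_apply, block_apply, FourierTransform.fourierInv_fourier_eq,
    SchwartzMap.smulLeftCLM_smulLeftCLM_apply (φ.pieceSym n).sym_growth (φ.nearSym n).sym_growth]
  have h : (φ.pieceSym n).sym * (φ.nearSym n).sym = (φ.pieceSym n).sym := by
    ext z
    simp only [Pi.mul_apply, UnitSymbol.sym, pieceSym, nearSym, ← Complex.ofReal_mul,
      piece_mul_near]
  rw [h]

/-- A tempered distribution with square summable blocks is bounded for the `L²` norm. -/
theorem norm_apply_le_of_summable_block {T : 𝓢'(Phase d, ℂ)} {U : ℕ → L2 d}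
    (hU : ∀ n, Lp.toTemperedDistribution (U n) = φ.block n T)
    (hs : Summable fun n => ‖U n‖ ^ 2) (ψ : 𝓢(Phase d, ℂ)) :
    ‖T ψ‖ ≤ √(∑' n, ‖U n‖ ^ 2) * √3 * ‖ψ.toLp 2 (volume : Measure (Phase d))‖ := by
  refine le_of_tendsto (φ.tendsto_sum_block T ψ).norm (Filter.Eventually.of_forall fun N => ?_)
  set u : L2 d := (𝓕⁻ ψ : 𝓢(Phase d, ℂ)).toLp 2 with hu
  have hterm : ∀ n, ‖φ.block n T ψ‖ ≤ ‖U n‖ * ‖(φ.nearSym n).mul u‖ := by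
    intro n
    rw [block_eq_block_near, ← hU]
    refine (norm_toTemperedDistribution_apply_le _ _).trans_eq ?_
    rw [← SchwartzMap.toLp_fourier_eq, Lp.norm_fourier_eq, hu, UnitSymbol.mul_toLp]
  have hnorm : ‖u‖ = ‖ψ.toLp 2 (volume : Measure (Phase d))‖ := by
    rw [hu, ← SchwartzMap.toLp_fourierInv_eq, UnitSymbol.norm_fourierInv]
  calc ‖∑ n ∈ Finset.range N, φ.block n T ψ‖
      ≤ ∑ n ∈ Finset.range N, ‖U n‖ * ‖(φ.nearSym n).mul u‖ :=
        norm_sum_le_of_le _ fun n _ => hterm n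
    _ ≤ √(∑ n ∈ Finset.range N, ‖U n‖ ^ 2) *
        √(∑ n ∈ Finset.range N, ‖(φ.nearSym n).mul u‖ ^ 2) := Real.sum_mul_le_sqrt_mul_sqrt _ _ _
    _ ≤ √(∑' n, ‖U n‖ ^ 2) * √(3 * ‖u‖ ^ 2) := by
        exact mul_le_mul
          (Real.sqrt_le_sqrt (hs.sum_le_tsum _ fun _ _ => sq_nonneg _))
          (Real.sqrt_le_sqrt (φ.sum_norm_near_mul_sq_le N u)) (Real.sqrt_nonneg _)
          (Real.sqrt_nonneg _)
    _ = _ := by rw [Real.sqrt_mul (by norm_num), Real.sqrt_sq (norm_nonneg _), hnorm, mul_assoc]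

/-- Density of Schwartz functions extends `T` to a bounded functional on `L²`; Riesz represents it,
with `star` again undoing the conjugation. -/
theorem exists_toTemperedDistribution_of_bound {T : 𝓢'(Phase d, ℂ)} {C : ℝ}
    (h : ∀ ψ : 𝓢(Phase d, ℂ), ‖T ψ‖ ≤ C * ‖ψ.toLp 2 (volume : Measure (Phase d))‖) :
    ∃ F : L2 d, Lp.toTemperedDistribution F = T := by
  have hdense := SchwartzMap.denseRange_toLpCLM (E := Phase d) (F := ℂ) (p := 2)
    (μ := volume) (by norm_num)
  let e : 𝓢(Phase d, ℂ) →ₗ[ℂ] L2 d := (SchwartzMap.toLpCLM ℂ ℂ 2 volume).toLinearMap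
  let T' : 𝓢(Phase d, ℂ) →ₗ[ℂ] ℂ :=
    { toFun := T, map_add' := map_add T, map_smul' := map_smul T }
  let L : L2 d →L[ℂ] ℂ := T'.extendOfNorm e
  have hL : ∀ ψ : 𝓢(Phase d, ℂ), L (ψ.toLp 2 volume) = T ψ := fun ψ =>
    LinearMap.extendOfNorm_eq (f := T') (e := e) hdense ⟨C, h⟩ ψ
  let w : L2 d := (InnerProductSpace.toDual ℂ (L2 d)).symm L
  refine ⟨star w, ?_⟩
  ext ψ
  rw [← hL, ← InnerProductSpace.toDual_symm_apply, Lp.toTemperedDistribution_apply, L2.inner_def]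
  refine integral_congr_ae ?_
  filter_upwards [Lp.coeFn_star w, ψ.coeFn_toLp 2] with z h1 h2
  rw [h1, h2]
  simp [w]

end Cutoff

theorem MemSobolev.exists_toTemperedDistribution {φ : Cutoff d} {s : ℝ} (hs : 0 ≤ s)
    {f : 𝓢'(Phase d, ℂ)} (hf : MemSobolev φ s f) :
    ∃ F : L2 d, Lp.toTemperedDistribution F = f := by
  rw [memSobolev_iff] at hf
  have hone : ∀ n : ℕ, (1 : ℝ≥0∞) ≤ ENNReal.ofReal (((2 : ℝ) ^ (s * n)) ^ 2) := by
    intro n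
    rw [← ENNReal.ofReal_one]
    exact ENNReal.ofReal_le_ofReal (one_le_pow₀ (Real.one_le_rpow (by norm_num) (by positivity)))
  have hlt : ∑' n : ℕ, distLpNorm 2 (φ.block n f) ^ 2 < ⊤ := by
    refine lt_of_le_of_lt (ENNReal.tsum_le_tsum fun n => ?_) hf
    simpa using mul_le_mul_left (hone n) (distLpNorm 2 (φ.block n f) ^ 2)
  have hfin : ∀ n, distLpNorm 2 (φ.block n f) < ⊤ := fun n =>
    (ENNReal.pow_lt_top_iff (n := 2)).1
      (lt_of_le_of_lt (ENNReal.le_tsum (f := fun n => distLpNorm 2 (φ.block n f) ^ 2) n) hlt)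
      |>.resolve_right (by norm_num)
  choose U hU hUle using fun n => exists_toTemperedDistribution_eq (hfin n)
  have hsum : Summable fun n => ‖U n‖ ^ 2 := by
    have h1 : ∑' n, ENNReal.ofReal (‖U n‖ ^ 2) ≠ ⊤ := by
      refine (lt_of_le_of_lt (ENNReal.tsum_le_tsum fun n => ?_) hlt).ne
      rw [ENNReal.ofReal_pow (norm_nonneg _), ofReal_norm]
      exact pow_le_pow_left' (hUle n) 2
    have h2 := ENNReal.summable_toReal h1
    refine h2.congr fun n => ?_
    rw [ENNReal.toReal_ofReal (by positivity)]
  exact Cutoff.exists_toTemperedDistribution_of_bound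
    (φ.norm_apply_le_of_summable_block hU hsum)

/-! ### Hölder distributions are bounded functions -/

theorem MemHolder.exists_block {φ : Cutoff d} {r : ℝ} {g : 𝓢'(Phase d, ℂ)}
    (hg : MemHolder φ r g) : ∃ G : ℕ → Linf d,
      (∀ n, Lp.toTemperedDistribution (G n) = φ.block n g) ∧
      ∀ n, ‖G n‖ ≤ (holderNorm φ r g).toReal * 2 ^ r * ((2 : ℝ) ^ (-r)) ^ n := by
  have hpos : ∀ n : ℕ, 0 < (2 : ℝ) ^ (r * ((n : ℝ) - 1)) := fun n => by positivity
  have hle : ∀ n : ℕ, (2 : ℝ≥0∞) ^ (r * ((n : ℝ) - 1)) * distLpNorm ⊤ (φ.block n g) ≤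
      holderNorm φ r g := by
    intro n
    rw [holderNorm, besovNorm, if_pos rfl]
    exact le_iSup (fun n : ℕ => (2 : ℝ≥0∞) ^ (r * ((n : ℝ) - 1)) * distLpNorm ⊤ (φ.block n g)) n
  have hfin : ∀ n, distLpNorm ⊤ (φ.block n g) < ⊤ := by
    intro n
    refine ENNReal.lt_top_of_mul_ne_top_right (lt_of_le_of_lt (hle n) hg).ne ?_
    rw [two_rpow_eq_ofReal]
    simpa using hpos n
  choose G hG hGle using fun n => exists_toTemperedDistribution_eq (hfin n)
  refine ⟨G, hG, fun n => ?_⟩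
  have h1 : ENNReal.ofReal ((2 : ℝ) ^ (r * ((n : ℝ) - 1)) * ‖G n‖) ≤ holderNorm φ r g := by
    rw [ENNReal.ofReal_mul (hpos n).le, ofReal_norm, ← two_rpow_eq_ofReal]
    exact (mul_le_mul_right (hGle n) _).trans (hle n)
  have h2 := (ENNReal.ofReal_le_iff_le_toReal hg.ne).1 h1
  -- The index `n` stands for scale `n - 1`, whence the extra `2 ^ r`.
  have h3 : (2 : ℝ) ^ r * ((2 : ℝ) ^ (-r)) ^ n = ((2 : ℝ) ^ (r * ((n : ℝ) - 1)))⁻¹ := by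
    rw [← Real.rpow_natCast, ← Real.rpow_mul (by norm_num), ← Real.rpow_add (by norm_num),
      ← Real.rpow_neg (by norm_num)]
    ring_nf
  rw [mul_assoc, h3, ← div_eq_mul_inv, le_div_iff₀ (hpos n), mul_comm]
  exact h2

/-- Convergence in `L^∞` implies weak convergence, so both sums have the same limit against each
test function. -/
theorem Cutoff.toTemperedDistribution_tsum (φ : Cutoff d) {T : 𝓢'(Phase d, ℂ)} {G : ℕ → Linf d}
    (hG : ∀ n, Lp.toTemperedDistribution (G n) = φ.block n T) (hsum : Summable G) :
    Lp.toTemperedDistribution (∑' n, G n) = T := by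
  ext ψ
  refine tendsto_nhds_unique ?_ (φ.tendsto_sum_block T ψ)
  have h := (hsum.hasSum.mapL (PointwiseConvergenceCLM.evalCLM (RingHom.id ℂ) ℂ ψ ∘L
    Lp.toTemperedDistributionCLM ℂ (volume : Measure (Phase d)) ⊤)).tendsto_sum_nat
  refine h.congr fun N => Finset.sum_congr rfl fun n _ => ?_
  rw [← hG]
  rfl

theorem isPointwiseProduct_mulL (G : Linf d) (F : L2 d) :
    IsPointwiseProduct (Lp.toTemperedDistribution G) (Lp.toTemperedDistribution F)
      (Lp.toTemperedDistribution (mulL d G F)) :=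
  ⟨G, F, isRepresentedBy_toTemperedDistribution G, isRepresentedBy_toTemperedDistribution F,
    (isRepresentedBy_toTemperedDistribution (mulL d G F)).congr (coeFn_mulL G F)⟩

end Kinetic

end

/-! ### The product estimate -/

theorem proposition2p6 (d : ℕ) (φ : Kinetic.Cutoff d) (s r : ℝ) (hs : 0 ≤ s) (hr : 0 ≤ r)
    (hsr : s < r) (hint : ∀ m : ℤ, r ≠ (m : ℝ)) :
    ∃ C : ℝ, 0 < C ∧ ∀ f g : 𝓢'(Kinetic.Phase d, ℂ),
      Kinetic.MemSobolev φ s f → Kinetic.MemHolder φ r g →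
        ∃ h : 𝓢'(Kinetic.Phase d, ℂ), Kinetic.IsPointwiseProduct g f h ∧
          Kinetic.MemSobolev φ s h ∧
          Kinetic.sobolevNorm s h ≤
            ENNReal.ofReal C * Kinetic.holderNorm φ r g * Kinetic.sobolevNorm s f := by
  have hrpos : 0 < r := hs.trans_lt hsr
  set ρ : ℝ := 2 ^ (-r) with hρ
  have hρ0 : 0 < ρ := by positivity
  have hρ1 : ρ < 1 := Real.rpow_lt_one_of_one_lt_of_neg (by norm_num) (by linarith)
  have hκ : 2 ^ s * ρ < 1 := by
    rw [hρ, ← Real.rpow_add (by norm_num)]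
    exact Real.rpow_lt_one_of_one_lt_of_neg (by norm_num) (by linarith)
  have h1κ : 0 < (1 - (2 ^ s * ρ) ^ 2)⁻¹ :=
    inv_pos.2 (sub_pos.2 (pow_lt_one₀ (by positivity) hκ (by norm_num)))
  have h1ρ : 0 < 1 - ρ := sub_pos.2 hρ1
  set B : ℝ := 2 ^ r / (1 - ρ) / ρ ^ 3 with hB
  have hB0 : 0 < B := by positivity
  -- The factor `2 * 2 ^ s` is from `weightSq_le`, the rest from `dyadicSq_mulL_tsum_le` with `K = M
  -- * 2 ^ r` and `M ^ 2` taken out. It bounds squared norms, so the final constant is `√C₁`.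
  set C₁ : ℝ := 2 * 2 ^ s * (2 * B ^ 2 * (3 * 128 ^ s + (1 - (2 ^ s * ρ) ^ 2)⁻¹)) with hC₁
  have hC₁0 : 0 < C₁ := by positivity
  refine ⟨√C₁, Real.sqrt_pos.2 hC₁0, fun f g hf hg => ?_⟩
  obtain ⟨F, rfl⟩ := hf.exists_toTemperedDistribution hs
  obtain ⟨G, hG, hGn⟩ := hg.exists_block
  have hM : ENNReal.ofReal (Kinetic.holderNorm φ r g).toReal = Kinetic.holderNorm φ r g :=
    ENNReal.ofReal_toReal hg.ne
  set M : ℝ := (Kinetic.holderNorm φ r g).toReal with hMdef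
  have hM0 : 0 ≤ M := ENNReal.toReal_nonneg
  have hsum : Summable G := Kinetic.Cutoff.summable_of_norm_le_geometric hρ0 hρ1 hGn
  have hprod := φ.dyadicSq_mulL_tsum_le hG (by positivity) hρ0 hρ1 hGn hs hκ F
  have hfD := (Kinetic.memSobolev_toTemperedDistribution_iff φ s F).1 hf
  have hfW : Kinetic.weightSq s F < ⊤ :=
    (φ.weightSq_le hs F).trans_lt (ENNReal.mul_lt_top ENNReal.ofReal_lt_top hfD)
  refine ⟨Lp.toTemperedDistribution (Kinetic.mulL d (∑' n, G n) F), ?_, ?_, ?_⟩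
  · have := Kinetic.isPointwiseProduct_mulL (∑' n, G n) F
    rwa [φ.toTemperedDistribution_tsum hG hsum] at this
  · rw [Kinetic.memSobolev_toTemperedDistribution_iff]
    exact hprod.trans_lt (ENNReal.mul_lt_top ENNReal.ofReal_lt_top hfW)
  · rw [Kinetic.sobolevNorm_toTemperedDistribution, Kinetic.sobolevNorm_toTemperedDistribution]
    have hW : Kinetic.weightSq s (Kinetic.mulL d (∑' n, G n) F) ≤
        ENNReal.ofReal (C₁ * M ^ 2) * Kinetic.weightSq s F := by
      refine (φ.weightSq_le hs _).trans ((mul_le_mul_right hprod _).trans_eq ?_)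
      rw [← mul_assoc, ← ENNReal.ofReal_mul (by positivity)]
      congr 2
      rw [hC₁, hB]
      ring
    have hsq : ENNReal.ofReal (C₁ * M ^ 2) ^ (1 / 2 : ℝ) =
        ENNReal.ofReal √C₁ * Kinetic.holderNorm φ r g := by
      rw [ENNReal.ofReal_rpow_of_nonneg (by positivity) (by norm_num), ← Real.sqrt_eq_rpow,
        Real.sqrt_mul hC₁0.le, Real.sqrt_sq hM0, ENNReal.ofReal_mul (Real.sqrt_nonneg _), hM]
    calc (Kinetic.jac d * Kinetic.weightSq s (Kinetic.mulL d (∑' n, G n) F)) ^ (1 / 2 : ℝ)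
        ≤ (ENNReal.ofReal (C₁ * M ^ 2) * (Kinetic.jac d * Kinetic.weightSq s F)) ^ (1 / 2 : ℝ) := by
          refine ENNReal.rpow_le_rpow ?_ (by norm_num)
          rw [mul_left_comm]
          exact mul_le_mul_right hW _
      _ = _ := by rw [ENNReal.mul_rpow_of_nonneg _ _ (by norm_num), hsq]
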